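/- Let $c>0$, let $2\le n\le\infty$, and let $g(t,x,u,p)$ be a function of class $C^n$ on all of $\mathbb{R}^4$ (this is the meaning of "non-singular"). Consider the nonlinear wave equation $u_{tt}+g(t,x,u,u_t)=c^2u_{xx}$ (called damped if $g_{u_t}\not\equiv0$). A function $Q(t,x,u,u_t,u_x)$ is called a multiplier of this equation if there are $C^n$ functions $T$ and $\Psi$ of $t$, $x$, $u$, $u_t$ and finitely many $x$-derivatives of $u$ and $u_t$ such that $$(u_{tt}-c^2u_{xx}+g(t,x,u,u_t))\,Q=D_tT+D_x\Psi$$ holds identically, i.e. for every smooth function $u(t,x)$ on $\mathbb{R}^2$, where $D_t,D_x$ are the total derivatives. Let $a,b,c_0,c_1,c_2$ be real constants, with $c_0,c_1,c_2$ not all zero. Then $$Q=e^{at+bx}(c_1u_t+c_2u_x+c_0u)$$ is a multiplier of the equation if and only if, for some real function $f$ of class $C^n$ on $\mathbb{R}^2$, one of the following three cases holds, with the stated $Q$ up to a non-zero constant factor: (i) $g=a u_t+f(t,u)$ and $Q=e^{at}u_x$; (ii) $g=a u_t+f\big(x-\tilde c t,\,e^{\frac a2 t}u\big)e^{-\frac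 a2 t}$ and $Q=e^{at}\big(u_t+\tilde c u_x+\tfrac a2 u\big)$, for some real constant $\tilde c$; (iii) $g=(a\pm cb)u_t+\tfrac14(a\pm cb)^2u+f\big(x\pm ct,\,e^{\frac{a\pm cb}{2}t}u\big)e^{-\frac{a\mp3cb}{2}t}$ and $Q=e^{at+bx}\big(u_t\mp cu_x+\tfrac{a\pm cb}{2}u\big)$, with either the upper signs throughout or the lower signs throughout. In particular, a damped equation with non-singular $g$ admits such a multiplier only if its damping is linear with constant coefficient. In each case $f$ is an arbitrary $C^n$ function. -/

import Mathlib

open scoped ContDiff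

namespace DampedWave

noncomputable section

/-- A point of the jet space: `t`, `x`, the values of `u, u_x, …, ∂ₓᴺ u`, and the values of
`u_t, ∂ₓ u_t, …, ∂ₓᴺ u_t`. -/
abbrev Jet (N : ℕ) : Type := ℝ × ℝ × (Fin (N + 1) → ℝ) × (Fin (N + 1) → ℝ)

/-- The time derivative `u_t` of a function `u(t, x)`. -/
def dt (u : ℝ → ℝ → ℝ) (t x : ℝ) : ℝ := deriv (fun s => u s x) t

/-- The space derivative `u_x` of a function `u(t, x)`. -/
def dx (u : ℝ → ℝ → ℝ) (t x : ℝ) : ℝ := deriv (fun y => u t y) x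

/-- The jet of a function `u(t, x)` at the point `(t, x)`. -/
def jet (N : ℕ) (u : ℝ → ℝ → ℝ) (t x : ℝ) : Jet N :=
  (t, x, fun k => iteratedDeriv (k : ℕ) (fun y => u t y) x,
    fun k => iteratedDeriv (k : ℕ) (fun y => dt u t y) x)

/-- `Q(t, x, u, u_t, u_x)` is a (conservation law) multiplier of the wave equation
`u_tt + g(t, x, u, u_t) = c² u_xx`: there are a density `T` and a flux `Ψ`, functions of class `Cⁿ`
of `t`, `x`, `u`, `u_t` and finitely many `x`-derivatives of `u` and `u_t`, such that
`(u_tt - c² u_xx + g) Q = D_t T + D_x Ψ` holds identically, i.e. for every smooth function `u(t, x)`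
(not only for solutions). The total derivatives are the derivatives along `u`. -/
def IsMultiplier (n : ℕ∞) (c : ℝ) (g : ℝ → ℝ → ℝ → ℝ → ℝ) (Q : ℝ → ℝ → ℝ → ℝ → ℝ → ℝ) : Prop :=
  ∃ (N : ℕ) (T Ψ : Jet N → ℝ), ContDiff ℝ n T ∧ ContDiff ℝ n Ψ ∧
    ∀ u : ℝ → ℝ → ℝ, ContDiff ℝ ∞ (fun z : ℝ × ℝ => u z.1 z.2) → ∀ t x : ℝ,
      (dt (dt u) t x - c ^ 2 * dx (dx u) t x + g t x (u t x) (dt u t x)) *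
          Q t x (u t x) (dt u t x) (dx u t x) =
        deriv (fun s => T (jet N u s x)) t + deriv (fun y => Ψ (jet N u t y)) x

/-- The expression `e^{at+bx} (c₁ u_t + c₂ u_x + c₀ u)`; the last three arguments are
`u`, `p = u_t` and `q = u_x`. -/
def linQ (a b c₀ c₁ c₂ : ℝ) (t x u p q : ℝ) : ℝ :=
  Real.exp (a * t + b * x) * (c₁ * p + c₂ * q + c₀ * u)

end

end DampedWave

/-!
A multiplier is characterised by the vanishing of the Euler–Lagrange expression of
`(u_tt - c² u_xx + g) Q`, and for `Q = e^{at+bx} (c₁ u_t + c₂ u_x + c₀ u)` this condition splits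
into algebraic relations and a transport equation.

Necessity. Adding divergences to the principal part turns `(u_tt - c² u_xx + g) Q` into a
Lagrangian of first order (`multiplier_expression_eq`). If `Q` is a multiplier, this Lagrangian is
itself a divergence of local expressions, so its action does not change under compactly supported
variations (`integral_reducedLagrangian_variation`), and the Euler–Lagrange equation holds along
every function (`eulerLagrange`). Evaluated on quadratic polynomials it becomes an identity in
independent variables `t, x, u, u_t, u_x, u_tt, u_tx, u_xx`, affine in the last three
(`determining_equation`). Their coefficients force `g_p` to be constant: if `c₂ ≠ 0` this is the
coefficient of `u_tx`, and if `c₂ = 0` it is an ordinary differential equation in `p = u_t` whose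
solutions other than the constant are singular at `p = -a u / 2` (`exists_constant_damping`). The
relations left among `a, b, c₀, c₁, c₂` give `c₁ = 0`, or `b = 0`, or `c₂ = ∓ c c₁`, which are the
three cases, and the remaining equation is a linear transport equation for `g(t, x, u, 0)`, solved
by characteristics (`eq_of_transport`); the function `f` is its initial profile at `t = 0`, or at
`x = 0` in case (i).

Sufficiency. With `F` a primitive of `f` in its last argument, jointly of class `Cⁿ`
(`exists_contDiff_primitive`), density and flux are explicit. In case (ii) they are the energy and
momentum of `w = e^{at/2} u`. In case (iii), with `s = ± c` and `w = e^{(a+sb)t/2} u`, the principal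
part factors as `(∂_t + s ∂_x)(∂_t - s ∂_x) w`, and the exponential weight is constant along
`∂_t + s ∂_x`, while the argument `x + s t` of `f` is constant along `∂_t - s ∂_x`.
-/

open scoped ContDiff

namespace DampedWave

noncomputable section

open MeasureTheory

/-! ### Partial derivatives in the plane -/

/-- The partial derivative `∂U/∂t` of a function of `(t, x)`. -/
def partialT (U : ℝ × ℝ → ℝ) (z : ℝ × ℝ) : ℝ := fderiv ℝ U z (1, 0)

/-- The partial derivative `∂U/∂x` of a function of `(t, x)`. -/
def partialX (U : ℝ × ℝ → ℝ) (z : ℝ × ℝ) : ℝ := fderiv ℝ U z (0, 1)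

theorem hasDerivAt_partialT {U : ℝ × ℝ → ℝ} (hU : Differentiable ℝ U) (t x : ℝ) :
    HasDerivAt (fun s => U (s, x)) (partialT U (t, x)) t :=
  (hU (t, x)).hasFDerivAt.comp_hasDerivAt t ((hasDerivAt_id t).prodMk (hasDerivAt_const t x))

theorem hasDerivAt_partialX {U : ℝ × ℝ → ℝ} (hU : Differentiable ℝ U) (t x : ℝ) :
    HasDerivAt (fun y => U (t, y)) (partialX U (t, x)) x :=
  (hU (t, x)).hasFDerivAt.comp_hasDerivAt x ((hasDerivAt_const x t).prodMk (hasDerivAt_id x))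

theorem contDiff_partialT {m k : WithTop ℕ∞} {U : ℝ × ℝ → ℝ} (hU : ContDiff ℝ k U)
    (h : m + 1 ≤ k) : ContDiff ℝ m (partialT U) :=
  (hU.fderiv_right h).clm_apply contDiff_const

theorem contDiff_partialX {m k : WithTop ℕ∞} {U : ℝ × ℝ → ℝ} (hU : ContDiff ℝ k U)
    (h : m + 1 ≤ k) : ContDiff ℝ m (partialX U) :=
  (hU.fderiv_right h).clm_apply contDiff_const

theorem contDiff_infty_partialT {U : ℝ × ℝ → ℝ} (hU : ContDiff ℝ ∞ U) :
    ContDiff ℝ ∞ (partialT U) :=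
  contDiff_partialT hU (by simp)

theorem contDiff_infty_partialX {U : ℝ × ℝ → ℝ} (hU : ContDiff ℝ ∞ U) :
    ContDiff ℝ ∞ (partialX U) :=
  contDiff_partialX hU (by simp)

theorem differentiable_of_contDiff_infty {U : ℝ × ℝ → ℝ} (hU : ContDiff ℝ ∞ U) :
    Differentiable ℝ U :=
  hU.differentiable (by simp)

/-- Mixed partial derivatives commute. -/
theorem partialX_partialT {U : ℝ × ℝ → ℝ} (hU : ContDiff ℝ ∞ U) (z : ℝ × ℝ) :
    partialX (partialT U) z = partialT (partialX U) z := by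
  have hd : DifferentiableAt ℝ (fderiv ℝ U) z :=
    (hU.fderiv_right (m := 1) (by norm_cast)).differentiable (by simp) z
  have hs : IsSymmSndFDerivAt ℝ U z :=
    hU.contDiffAt.isSymmSndFDerivAt (by simpa using (by norm_cast : (2 : WithTop ℕ∞) ≤ ∞))
  have h : ∀ v w : ℝ × ℝ, fderiv ℝ (fun y => fderiv ℝ U y v) z w = fderiv ℝ (fderiv ℝ U) z w v :=
    fun v w => by
      rw [fderiv_clm_apply hd (differentiableAt_const v)]
      simp
  exact (h _ _).trans ((hs _ _).trans (h _ _).symm)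

theorem partialT_add {U V : ℝ × ℝ → ℝ} (hU : Differentiable ℝ U) (hV : Differentiable ℝ V)
    (z : ℝ × ℝ) : partialT (fun y => U y + V y) z = partialT U z + partialT V z := by
  simp [partialT, fderiv_fun_add (hU z) (hV z)]

theorem partialX_add {U V : ℝ × ℝ → ℝ} (hU : Differentiable ℝ U) (hV : Differentiable ℝ V)
    (z : ℝ × ℝ) : partialX (fun y => U y + V y) z = partialX U z + partialX V z := by
  simp [partialX, fderiv_fun_add (hU z) (hV z)]

theorem partialT_sub {U V : ℝ × ℝ → ℝ} (hU : Differentiable ℝ U) (hV : Differentiable ℝ V)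
    (z : ℝ × ℝ) : partialT (fun y => U y - V y) z = partialT U z - partialT V z := by
  simp [partialT, fderiv_fun_sub (hU z) (hV z)]

theorem partialX_sub {U V : ℝ × ℝ → ℝ} (hU : Differentiable ℝ U) (hV : Differentiable ℝ V)
    (z : ℝ × ℝ) : partialX (fun y => U y - V y) z = partialX U z - partialX V z := by
  simp [partialX, fderiv_fun_sub (hU z) (hV z)]

/-! ### The Euler–Lagrange equation of a null Lagrangian -/

/-- Integration by parts in the plane against a compactly supported test function. -/
theorem integral_fderiv_mul_eq_neg {φ B : ℝ × ℝ → ℝ} (hφ : ContDiff ℝ 1 φ)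
    (hφc : HasCompactSupport φ) (hB : ContDiff ℝ 1 B) (v : ℝ × ℝ) :
    ∫ z, fderiv ℝ φ z v * B z = - ∫ z, φ z * fderiv ℝ B z v := by
  have h1 : Continuous fun z => fderiv ℝ φ z v :=
    (hφ.continuous_fderiv (by simp)).clm_apply continuous_const
  have h2 : Continuous fun z => fderiv ℝ B z v :=
    (hB.continuous_fderiv (by simp)).clm_apply continuous_const
  have h := integral_mul_fderiv_eq_neg_fderiv_mul_of_integrable (μ := volume) (f := φ) (g := B)
    (v := v)
    ((h1.mul hB.continuous).integrable_of_hasCompactSupport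
      ((hφc.fderiv_apply ℝ v).mul_right))
    ((hφ.continuous.mul h2).integrable_of_hasCompactSupport hφc.mul_right)
    ((hφ.continuous.mul hB.continuous).integrable_of_hasCompactSupport hφc.mul_right)
    (fun z _ => hφ.differentiable (by simp) z) (fun z _ => hB.differentiable (by simp) z)
  rw [h, neg_neg]

/-- A divergence with compactly supported density and flux has integral zero. -/
theorem integral_divergence_eq_zero {A B : ℝ × ℝ → ℝ} (hA : ContDiff ℝ 1 A)
    (hAc : HasCompactSupport A) (hB : ContDiff ℝ 1 B) (hBc : HasCompactSupport B) :
    ∫ z, (partialT A z + partialX B z) = 0 := by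
  have hA' : Integrable (partialT A) :=
    (contDiff_partialT hA (m := 0) (by simp)).continuous.integrable_of_hasCompactSupport
      (hAc.fderiv_apply ℝ _)
  have hB' : Integrable (partialX B) :=
    (contDiff_partialX hB (m := 0) (by simp)).continuous.integrable_of_hasCompactSupport
      (hBc.fderiv_apply ℝ _)
  have h1 := integral_fderiv_mul_eq_neg hA hAc (contDiff_const (c := (1 : ℝ))) (1, 0)
  have h2 := integral_fderiv_mul_eq_neg hB hBc (contDiff_const (c := (1 : ℝ))) (0, 1)
  simp only [mul_one, fderiv_fun_const, Pi.zero_apply,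
    zero_apply, mul_zero, integral_zero, neg_zero] at h1 h2
  rw [integral_add hA' hB']
  simp only [partialT, partialX, h1, h2, add_zero]

/-- Differentiation under the integral sign at `ε = 0`, for a compactly supported variation `V`. -/
theorem integral_fderiv_variation_eq_zero {E : Type*} [NormedAddCommGroup E] [NormedSpace ℝ E]
    {L : E → ℝ} (hL : ContDiff ℝ 1 L) {s V : ℝ × ℝ → E} (hs : Continuous s) (hV : Continuous V)
    (hVc : HasCompactSupport V)
    (h : ∀ ε : ℝ, ∫ z, (L (s z + ε • V z) - L (s z)) = 0) :
    ∫ z, fderiv ℝ L (s z) (V z) = 0 := by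
  have hLd : Differentiable ℝ L := hL.differentiable (by simp)
  have hL' : Continuous (fderiv ℝ L) := hL.continuous_fderiv (by simp)
  have hpath : Continuous fun w : ℝ × (ℝ × ℝ) => s w.2 + w.1 • V w.2 := by fun_prop
  obtain ⟨C, hC⟩ : ∃ C, ∀ w ∈ Metric.closedBall (0 : ℝ) 1 ×ˢ tsupport V,
      ‖fderiv ℝ L (s w.2 + w.1 • V w.2)‖ ≤ C :=
    ((isCompact_closedBall (0 : ℝ) 1).prod hVc).exists_bound_of_continuousOn
      (hL'.comp hpath).continuousOn
  have hmeas : ∀ ε : ℝ, Continuous fun z => L (s z + ε • V z) - L (s z) := fun ε =>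
    (hL.continuous.comp (hs.add (hV.const_smul ε))).sub (hL.continuous.comp hs)
  have key := hasDerivAt_integral_of_dominated_loc_of_deriv_le (μ := (volume : Measure (ℝ × ℝ)))
    (F := fun (ε : ℝ) z => L (s z + ε • V z) - L (s z))
    (F' := fun (ε : ℝ) z => fderiv ℝ L (s z + ε • V z) (V z))
    (x₀ := (0 : ℝ)) (s := Metric.ball 0 1) (bound := fun z => C * ‖V z‖)
    (Metric.ball_mem_nhds _ one_pos)
    (Filter.Eventually.of_forall fun ε => (hmeas ε).aestronglyMeasurable)
    (by simp)
    (by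
      have : Continuous fun z => fderiv ℝ L (s z + (0 : ℝ) • V z) (V z) :=
        (hL'.comp (hs.add (hV.const_smul _))).clm_apply hV
      exact this.aestronglyMeasurable)
    (Filter.Eventually.of_forall fun z ε hε => by
      by_cases hz : z ∈ tsupport V
      · exact (ContinuousLinearMap.le_opNorm _ _).trans
          (mul_le_mul_of_nonneg_right (hC (ε, z) ⟨Metric.ball_subset_closedBall hε, hz⟩)
            (norm_nonneg _))
      · simp [image_eq_zero_of_notMem_tsupport hz])
    ((continuous_const.mul hV.norm).integrable_of_hasCompactSupport hVc.norm.mul_left)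
    (Filter.Eventually.of_forall fun z ε _ => by
      have h1 : HasDerivAt (fun ε : ℝ => s z + ε • V z) (V z) ε := by
        simpa using ((hasDerivAt_id ε).smul_const (V z)).const_add (s z)
      exact ((hLd _).hasFDerivAt.comp_hasDerivAt ε h1).sub_const _)
  have h0 : (fun ε : ℝ => ∫ z, (L (s z + ε • V z) - L (s z))) = fun _ => 0 := funext h
  have h1 := key.2
  rw [h0] at h1
  simpa using h1.unique (hasDerivAt_const (0 : ℝ) (0 : ℝ))

/-- The point `(t, x, u, u_t, u_x)` of first-order jet space attached to `U` at `(t, x)`. -/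
def firstJet (U : ℝ × ℝ → ℝ) (z : ℝ × ℝ) : ℝ × ℝ × ℝ × ℝ × ℝ :=
  (z.1, z.2, U z, partialT U z, partialX U z)

theorem contDiff_firstJet {U : ℝ × ℝ → ℝ} (hU : ContDiff ℝ ∞ U) : ContDiff ℝ ∞ (firstJet U) :=
  contDiff_fst.prodMk (contDiff_snd.prodMk (hU.prodMk
    ((contDiff_infty_partialT hU).prodMk (contDiff_infty_partialX hU))))

/-- The Euler–Lagrange equation of a first-order Lagrangian whose action is unchanged by every
compactly supported variation of every function: it holds along all functions. -/
theorem eulerLagrange {L : ℝ × ℝ × ℝ × ℝ × ℝ → ℝ} (hL : ContDiff ℝ 2 L)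
    (hnull : ∀ U φ : ℝ × ℝ → ℝ, ContDiff ℝ ∞ U → ContDiff ℝ ∞ φ → HasCompactSupport φ →
      ∫ z, (L (firstJet (fun y => U y + φ y) z) - L (firstJet U z)) = 0)
    {U : ℝ × ℝ → ℝ} (hU : ContDiff ℝ ∞ U) (z : ℝ × ℝ) :
    fderiv ℝ L (firstJet U z) (0, 0, 1, 0, 0) =
      partialT (fun y => fderiv ℝ L (firstJet U y) (0, 0, 0, 1, 0)) z +
      partialX (fun y => fderiv ℝ L (firstJet U y) (0, 0, 0, 0, 1)) z := by
  have hL' : ContDiff ℝ 1 (fderiv ℝ L) := hL.fderiv_right (by norm_num)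
  have hJ : ContDiff ℝ 1 (firstJet U) := (contDiff_firstJet hU).of_le (by norm_cast)
  have hc : ∀ v, ContDiff ℝ 1 fun y => fderiv ℝ L (firstJet U y) v := fun v =>
    (hL'.comp hJ).clm_apply contDiff_const
  set Lu := fun y => fderiv ℝ L (firstJet U y) (0, 0, 1, 0, 0) with hLu
  set Lp := fun y => fderiv ℝ L (firstJet U y) (0, 0, 0, 1, 0) with hLp
  set Lq := fun y => fderiv ℝ L (firstJet U y) (0, 0, 0, 0, 1) with hLq
  have hLu1 : ContDiff ℝ 1 Lu := hc _
  have hLp1 : ContDiff ℝ 1 Lp := hc _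
  have hLq1 : ContDiff ℝ 1 Lq := hc _
  have hpt : Continuous (partialT Lp) := (contDiff_partialT hLp1 (m := 0) (by simp)).continuous
  have hpx : Continuous (partialX Lq) := (contDiff_partialX hLq1 (m := 0) (by simp)).continuous
  have hE : Continuous fun y => Lu y - (partialT Lp y + partialX Lq y) :=
    hLu1.continuous.sub (hpt.add hpx)
  have hae : ∀ᵐ y, Lu y - (partialT Lp y + partialX Lq y) = 0 := by
    refine ae_eq_zero_of_integral_contDiff_smul_eq_zero hE.locallyIntegrable fun φ hφ hφc => ?_
    have hφ1 : ContDiff ℝ 1 φ := hφ.of_le (by norm_cast)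
    have hφt := (contDiff_infty_partialT hφ).continuous
    have hφx := (contDiff_infty_partialX hφ).continuous
    have hφtc : HasCompactSupport (partialT φ) := hφc.fderiv_apply ℝ _
    have hφxc : HasCompactSupport (partialX φ) := hφc.fderiv_apply ℝ _
    have hvar : ∫ y, fderiv ℝ L (firstJet U y)
        ((0 : ℝ), (0 : ℝ), φ y, partialT φ y, partialX φ y) = 0 := by
      refine integral_fderiv_variation_eq_zero (hL.of_le (by norm_num)) hJ.continuous
        (by have := hφ.continuous; fun_prop) ?_ fun ε => ?_
      · refine hφc.mono' fun y hy => ?_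
        by_contra hys
        have h0 : φ =ᶠ[nhds y] 0 := notMem_tsupport_iff_eventuallyEq.mp hys
        refine hy ?_
        have h1 : fderiv ℝ φ y = 0 := by rw [h0.fderiv_eq]; simp
        simp [partialT, partialX, h1, h0.eq_of_nhds]
      · have hεφ : ContDiff ℝ ∞ fun y => ε * φ y := contDiff_const.mul hφ
        have := hnull U (fun y => ε * φ y) hU hεφ hφc.mul_left
        refine Eq.trans (congrArg _ (funext fun y => ?_)) this
        congr 2
        have h1 : partialT (fun y => ε * φ y) y = ε * partialT φ y := by
          simp [partialT, fderiv_const_mul (differentiable_of_contDiff_infty hφ y)]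
        have h2 : partialX (fun y => ε * φ y) y = ε * partialX φ y := by
          simp [partialX, fderiv_const_mul (differentiable_of_contDiff_infty hφ y)]
        simp only [firstJet, partialT_add (differentiable_of_contDiff_infty hU)
          (differentiable_of_contDiff_infty hεφ), partialX_add
          (differentiable_of_contDiff_infty hU) (differentiable_of_contDiff_infty hεφ), h1, h2]
        simp
    have hsplit : ∀ y, fderiv ℝ L (firstJet U y)
        ((0 : ℝ), (0 : ℝ), φ y, partialT φ y, partialX φ y) =
        φ y * Lu y + (partialT φ y * Lp y + partialX φ y * Lq y) := fun y => by
      have : ((0 : ℝ), (0 : ℝ), φ y, partialT φ y, partialX φ y) =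
          φ y • ((0 : ℝ), (0 : ℝ), (1 : ℝ), (0 : ℝ), (0 : ℝ)) +
          (partialT φ y • ((0 : ℝ), (0 : ℝ), (0 : ℝ), (1 : ℝ), (0 : ℝ)) +
            partialX φ y • ((0 : ℝ), (0 : ℝ), (0 : ℝ), (0 : ℝ), (1 : ℝ))) := by simp
      rw [this, map_add, map_add, map_smul, map_smul, map_smul]
      rfl
    simp only [hsplit] at hvar
    have hi : ∀ {ψ B : ℝ × ℝ → ℝ}, Continuous ψ → HasCompactSupport ψ → Continuous B →
        Integrable fun y => ψ y * B y := fun h1 h2 h3 =>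
      (h1.mul h3).integrable_of_hasCompactSupport h2.mul_right
    have i1 := hi hφ.continuous hφc hLu1.continuous
    have i2 := hi hφt hφtc hLp1.continuous
    have i3 := hi hφx hφxc hLq1.continuous
    have i4 := hi hφ.continuous hφc hpt
    have i5 := hi hφ.continuous hφc hpx
    have p1 : ∫ y, partialT φ y * Lp y = - ∫ y, φ y * partialT Lp y :=
      integral_fderiv_mul_eq_neg hφ1 hφc hLp1 (1, 0)
    have p2 : ∫ y, partialX φ y * Lq y = - ∫ y, φ y * partialX Lq y :=
      integral_fderiv_mul_eq_neg hφ1 hφc hLq1 (0, 1)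
    have e1 := integral_add i1 (i2.add i3)
    have e2 := integral_add i2 i3
    have e3 := integral_sub i1 (i4.add i5)
    have e4 := integral_add i4 i5
    simp only [Pi.add_apply] at e1 e3
    simp only [smul_eq_mul, mul_sub, mul_add]
    linarith
  have := (Continuous.ae_eq_iff_eq volume hE (continuous_const (y := (0 : ℝ)))).mp hae
  exact sub_eq_zero.mp (congrFun this z)

/-! ### Smooth primitives with a parameter -/

/-- Parametric integrals over `[0, 1]` of functions of class `Cᵐ` are of class `Cᵐ`. -/
theorem contDiff_parametric_integral_nat {E F : Type} [NormedAddCommGroup E] [NormedSpace ℝ E]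
    [ProperSpace E] [NormedAddCommGroup F] [NormedSpace ℝ F] {m : ℕ} {f : E × ℝ → F}
    (hf : ContDiff ℝ m f) : ContDiff ℝ m fun y => ∫ s in (0 : ℝ)..1, f (y, s) := by
  induction m generalizing F with
  | zero =>
    exact contDiff_zero.mpr
      (intervalIntegral.continuous_parametric_intervalIntegral_of_continuous'
        (f := fun y s => f (y, s)) hf.continuous 0 1)
  | succ m ih =>
    have hfd : Differentiable ℝ f := hf.differentiable (by simp)
    set f' : E × ℝ → E →L[ℝ] F :=
      fun w => (fderiv ℝ f w).comp (ContinuousLinearMap.inl ℝ E ℝ) with hf'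
    have hf'm : ContDiff ℝ m f' :=
      (hf.fderiv_right (by norm_cast)).clm_comp contDiff_const
    refine contDiff_succ_iff_hasFDerivAt.mpr ⟨_, ih hf'm, fun y₀ => ?_⟩
    obtain ⟨C, hC⟩ : ∃ C, ∀ w ∈ Metric.closedBall y₀ 1 ×ˢ Set.Icc (0 : ℝ) 1, ‖f' w‖ ≤ C :=
      ((isCompact_closedBall y₀ 1).prod isCompact_Icc).exists_bound_of_continuousOn
        hf'm.continuous.continuousOn
    have hslice : ∀ y, Continuous fun s : ℝ => f (y, s) := fun y =>
      hf.continuous.comp (by fun_prop)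
    refine intervalIntegral.hasFDerivAt_integral_of_dominated_of_fderiv_le
      (F := fun y s => f (y, s)) (F' := fun y s => f' (y, s)) (bound := fun _ => C)
      (Metric.ball_mem_nhds y₀ one_pos)
      (Filter.Eventually.of_forall fun y => (hslice y).aestronglyMeasurable)
      ((hslice y₀).intervalIntegrable _ _)
      (hf'm.continuous.comp (by fun_prop : Continuous fun s : ℝ => (y₀, s))).aestronglyMeasurable
      (Filter.Eventually.of_forall fun s hs y hy => ?_)
      intervalIntegrable_const
      (Filter.Eventually.of_forall fun s hs y hy => ?_)
    · rw [Set.uIoc_of_le zero_le_one] at hs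
      exact hC (y, s) ⟨Metric.ball_subset_closedBall hy, Set.Ioc_subset_Icc_self hs⟩
    · exact (hfd (y, s)).hasFDerivAt.comp y (hasFDerivAt_prodMk_left y s)

theorem contDiff_parametric_integral {E F : Type} [NormedAddCommGroup E] [NormedSpace ℝ E]
    [ProperSpace E] [NormedAddCommGroup F] [NormedSpace ℝ F] {n : ℕ∞} {f : E × ℝ → F}
    (hf : ContDiff ℝ n f) : ContDiff ℝ n fun y => ∫ s in (0 : ℝ)..1, f (y, s) :=
  contDiff_iff_forall_nat_le.mpr fun m hm =>
    contDiff_parametric_integral_nat (hf.of_le (by exact_mod_cast hm))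

/-- A function of class `Cⁿ` of two variables has a primitive in its second variable that is
jointly of class `Cⁿ`. -/
theorem exists_contDiff_primitive {n : ℕ∞} {f : ℝ → ℝ → ℝ}
    (hf : ContDiff ℝ n fun z : ℝ × ℝ => f z.1 z.2) :
    ∃ F : ℝ × ℝ → ℝ, ContDiff ℝ n F ∧ ∀ y w, HasDerivAt (fun r => F (y, r)) (f y w) w := by
  -- The substitution `s ↦ s * w` moves the variable endpoint of `∫₀ʷ` into the integrand.
  refine ⟨fun z => z.2 * ∫ s in (0 : ℝ)..1, f z.1 (s * z.2), ?_, fun y w => ?_⟩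
  · refine contDiff_snd.mul (contDiff_parametric_integral
      (f := fun p : (ℝ × ℝ) × ℝ => f p.1.1 (p.2 * p.1.2)) ?_)
    exact hf.comp (g := fun z : ℝ × ℝ => f z.1 z.2)
      (f := fun p : (ℝ × ℝ) × ℝ => (p.1.1, p.2 * p.1.2)) (by fun_prop)
  · have hc : Continuous (f y) :=
      hf.continuous.comp (by fun_prop : Continuous fun r : ℝ => (y, r))
    simpa using intervalIntegral.integral_hasDerivAt_right (hc.intervalIntegrable 0 w)
      (hc.stronglyMeasurableAtFilter _ _) hc.continuousAt

/-- Chain rule for a function of two variables along a curve. -/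
theorem hasDerivAt_comp_curve {F : ℝ × ℝ → ℝ} (hF : Differentiable ℝ F) {α β : ℝ → ℝ}
    {α' β' t : ℝ} (hα : HasDerivAt α α' t) (hβ : HasDerivAt β β' t) :
    HasDerivAt (fun s => F (α s, β s))
      (α' * partialT F (α t, β t) + β' * partialX F (α t, β t)) t := by
  have h := (hF (α t, β t)).hasFDerivAt.comp_hasDerivAt t (hα.prodMk hβ)
  have e : (α', β') = α' • ((1 : ℝ), (0 : ℝ)) + β' • ((0 : ℝ), (1 : ℝ)) := by simp
  rw [e, map_add, map_smul, map_smul] at h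
  exact h

/-! ### Jets of functions on the plane -/

theorem contDiff_iterate_partialX {U : ℝ × ℝ → ℝ} (hU : ContDiff ℝ ∞ U) (k : ℕ) :
    ContDiff ℝ ∞ (partialX^[k] U) := by
  induction k with
  | zero => exact hU
  | succ k ih =>
    rw [Function.iterate_succ_apply']
    exact contDiff_infty_partialX ih

theorem iteratedDeriv_slice {U : ℝ × ℝ → ℝ} (hU : ContDiff ℝ ∞ U) (k : ℕ) (t x : ℝ) :
    iteratedDeriv k (fun y => U (t, y)) x = partialX^[k] U (t, x) := by
  induction k generalizing x with
  | zero => simp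
  | succ k ih =>
    rw [iteratedDeriv_succ, funext ih, Function.iterate_succ_apply']
    exact (hasDerivAt_partialX
      (differentiable_of_contDiff_infty (contDiff_iterate_partialX hU k)) t x).deriv

theorem dt_eq_partialT {U : ℝ × ℝ → ℝ} (hU : ContDiff ℝ ∞ U) (t x : ℝ) :
    dt (fun t x => U (t, x)) t x = partialT U (t, x) :=
  (hasDerivAt_partialT (differentiable_of_contDiff_infty hU) t x).deriv

theorem dx_eq_partialX {U : ℝ × ℝ → ℝ} (hU : ContDiff ℝ ∞ U) (t x : ℝ) :
    dx (fun t x => U (t, x)) t x = partialX U (t, x) :=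
  (hasDerivAt_partialX (differentiable_of_contDiff_infty hU) t x).deriv

/-- The jet of `U`, as a function on the plane, in terms of iterated partial derivatives. -/
def jetAt (N : ℕ) (U : ℝ × ℝ → ℝ) (z : ℝ × ℝ) : Jet N :=
  (z.1, z.2, fun k => partialX^[k] U z, fun k => partialX^[k] (partialT U) z)

theorem jet_eq_jetAt (N : ℕ) {U : ℝ × ℝ → ℝ} (hU : ContDiff ℝ ∞ U) (t x : ℝ) :
    jet N (fun t x => U (t, x)) t x = jetAt N U (t, x) := by
  simp only [jet, jetAt, dt_eq_partialT hU, iteratedDeriv_slice hU,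
    iteratedDeriv_slice (contDiff_infty_partialT hU)]

theorem contDiff_jetAt (N : ℕ) {U : ℝ × ℝ → ℝ} (hU : ContDiff ℝ ∞ U) :
    ContDiff ℝ ∞ (jetAt N U) :=
  contDiff_fst.prodMk (contDiff_snd.prodMk
    ((contDiff_pi.mpr fun k : Fin (N + 1) => contDiff_iterate_partialX hU k).prodMk
      (contDiff_pi.mpr fun k : Fin (N + 1) => contDiff_iterate_partialX (contDiff_infty_partialT hU) k)))

theorem partialT_congr {U V : ℝ × ℝ → ℝ} {z : ℝ × ℝ} (h : U =ᶠ[nhds z] V) :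
    partialT U =ᶠ[nhds z] partialT V := by
  filter_upwards [h.fderiv (𝕜 := ℝ)] with y hy
  simp [partialT, hy]

theorem partialX_congr {U V : ℝ × ℝ → ℝ} {z : ℝ × ℝ} (h : U =ᶠ[nhds z] V) :
    partialX U =ᶠ[nhds z] partialX V := by
  filter_upwards [h.fderiv (𝕜 := ℝ)] with y hy
  simp [partialX, hy]

theorem iterate_partialX_congr {U V : ℝ × ℝ → ℝ} {z : ℝ × ℝ} (h : U =ᶠ[nhds z] V) (k : ℕ) :
    partialX^[k] U =ᶠ[nhds z] partialX^[k] V := by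
  induction k with
  | zero => exact h
  | succ k ih =>
    simp only [Function.iterate_succ_apply']
    exact partialX_congr ih

theorem jetAt_congr (N : ℕ) {U V : ℝ × ℝ → ℝ} {z : ℝ × ℝ} (h : U =ᶠ[nhds z] V) :
    jetAt N U z = jetAt N V z := by
  simp only [jetAt, (iterate_partialX_congr h _).eq_of_nhds,
    (iterate_partialX_congr (partialT_congr h) _).eq_of_nhds]

theorem firstJet_congr {U V : ℝ × ℝ → ℝ} {z : ℝ × ℝ} (h : U =ᶠ[nhds z] V) :
    firstJet U z = firstJet V z := by
  simp only [firstJet, h.eq_of_nhds, (partialT_congr h).eq_of_nhds, (partialX_congr h).eq_of_nhds]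

/-- The definition of a multiplier in terms of partial derivatives on the plane. -/
theorem isMultiplier_iff {n : ℕ∞} {c : ℝ} {g : ℝ → ℝ → ℝ → ℝ → ℝ}
    {Q : ℝ → ℝ → ℝ → ℝ → ℝ → ℝ} :
    IsMultiplier n c g Q ↔
      ∃ (N : ℕ) (T Ψ : Jet N → ℝ), ContDiff ℝ n T ∧ ContDiff ℝ n Ψ ∧
        ∀ U : ℝ × ℝ → ℝ, ContDiff ℝ ∞ U → ∀ t x : ℝ,
          (partialT (partialT U) (t, x) - c ^ 2 * partialX (partialX U) (t, x) +
              g t x (U (t, x)) (partialT U (t, x))) *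
              Q t x (U (t, x)) (partialT U (t, x)) (partialX U (t, x)) =
            deriv (fun s => T (jetAt N U (s, x))) t + deriv (fun y => Ψ (jetAt N U (t, y))) x := by
  have hrw : ∀ U : ℝ × ℝ → ℝ, ContDiff ℝ ∞ U → ∀ t x : ℝ,
      (dt (dt fun t x => U (t, x)) t x = partialT (partialT U) (t, x)) ∧
      (dx (dx fun t x => U (t, x)) t x = partialX (partialX U) (t, x)) := by
    intro U hU t x
    have h1 : (dt fun t x => U (t, x)) = fun t x => partialT U (t, x) := by
      ext t x; exact dt_eq_partialT hU t x
    have h2 : (dx fun t x => U (t, x)) = fun t x => partialX U (t, x) := by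
      ext t x; exact dx_eq_partialX hU t x
    rw [h1, h2]
    exact ⟨dt_eq_partialT (contDiff_infty_partialT hU) t x,
      dx_eq_partialX (contDiff_infty_partialX hU) t x⟩
  constructor
  · rintro ⟨N, T, Ψ, hT, hΨ, h⟩
    refine ⟨N, T, Ψ, hT, hΨ, fun U hU t x => ?_⟩
    have := h (fun t x => U (t, x)) hU t x
    simpa only [(hrw U hU t x).1, (hrw U hU t x).2, dt_eq_partialT hU,
      dx_eq_partialX hU, jet_eq_jetAt N hU] using this
  · rintro ⟨N, T, Ψ, hT, hΨ, h⟩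
    refine ⟨N, T, Ψ, hT, hΨ, fun u hu t x => ?_⟩
    have := h (fun z => u z.1 z.2) hu t x
    have h12 := hrw _ hu t x
    have h3 := dt_eq_partialT hu t x
    have h4 := dx_eq_partialX hu t x
    have h5 := jet_eq_jetAt N hu
    simp only at h12 h3 h4 h5
    simp only [h12.1, h12.2, h3, h4, h5]
    exact this

/-- To exhibit a multiplier it is enough to give a density and a flux depending only on
`t, x, u, u_t, u_x`. -/
theorem isMultiplier_of_firstOrder {n : ℕ∞} {c : ℝ} {g : ℝ → ℝ → ℝ → ℝ → ℝ}
    {Q : ℝ → ℝ → ℝ → ℝ → ℝ → ℝ} {T Ψ : ℝ × ℝ × ℝ × ℝ × ℝ → ℝ}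
    (hT : ContDiff ℝ n T) (hΨ : ContDiff ℝ n Ψ)
    (h : ∀ U : ℝ × ℝ → ℝ, ContDiff ℝ ∞ U → ∀ t x : ℝ, ∃ T' Ψ' : ℝ,
      HasDerivAt (fun s => T (firstJet U (s, x))) T' t ∧
      HasDerivAt (fun y => Ψ (firstJet U (t, y))) Ψ' x ∧
      (partialT (partialT U) (t, x) - c ^ 2 * partialX (partialX U) (t, x) +
          g t x (U (t, x)) (partialT U (t, x))) *
          Q t x (U (t, x)) (partialT U (t, x)) (partialX U (t, x)) = T' + Ψ') :
    IsMultiplier n c g Q := by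
  have hπ : ContDiff ℝ n fun j : Jet 1 => (j.1, j.2.1, j.2.2.1 0, j.2.2.2 0, j.2.2.1 1) := by
    fun_prop
  refine isMultiplier_iff.mpr ⟨1, _, _, hT.comp hπ, hΨ.comp hπ, fun U hU t x => ?_⟩
  obtain ⟨T', Ψ', h1, h2, h3⟩ := h U hU t x
  rw [h3]
  exact congrArg₂ (· + ·) h1.deriv.symm h2.deriv.symm

/-! ### Explicit densities and fluxes -/

theorem hasDerivAt_exp_linear (r k t : ℝ) :
    HasDerivAt (fun s => Real.exp (r * s + k)) (Real.exp (r * t + k) * r) t := by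
  simpa using (((hasDerivAt_id t).const_mul r).add_const k).exp

/-- Multiplication by `u_x` when `g - a u_t` does not depend on `x`: the weighted conservation law
of momentum. -/
theorem isMultiplier_translation {n : ℕ∞} (hn : n ≠ 0) (c a k : ℝ) {f : ℝ → ℝ → ℝ}
    (hf : ContDiff ℝ n fun z : ℝ × ℝ => f z.1 z.2) :
    IsMultiplier n c (fun t _ u p => a * p + f t u)
      (fun t _ _ _ q => k * (Real.exp (a * t) * q)) := by
  obtain ⟨F, hF, hFd⟩ := exists_contDiff_primitive hf
  have hFdiff : Differentiable ℝ F := hF.differentiable (by exact_mod_cast hn)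
  refine isMultiplier_of_firstOrder
    (T := fun w => k * (Real.exp (a * w.1 + 0) * (w.2.2.2.1 * w.2.2.2.2)))
    (Ψ := fun w => k * (Real.exp (a * w.1 + 0) *
      (F (w.1, w.2.2.1) - w.2.2.2.1 ^ 2 / 2 - c ^ 2 * w.2.2.2.2 ^ 2 / 2)))
    (by fun_prop) (by fun_prop) fun U hU t x => ?_
  have hp := differentiable_of_contDiff_infty (contDiff_infty_partialT hU)
  have hq := differentiable_of_contDiff_infty (contDiff_infty_partialX hU)
  have ux := hasDerivAt_partialX (differentiable_of_contDiff_infty hU) t x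
  have hFx := hasDerivAt_comp_curve hFdiff (hasDerivAt_const x t) ux
  have hFw := (hasDerivAt_partialX hFdiff t (U (t, x))).unique (hFd t (U (t, x)))
  rw [hFw] at hFx
  refine ⟨_, _, ((hasDerivAt_exp_linear a 0 t).mul
      ((hasDerivAt_partialT hp t x).mul (hasDerivAt_partialT hq t x))).const_mul k,
    ((((hFx.sub (((hasDerivAt_partialX hp t x).pow 2).div_const 2)).sub
      ((((hasDerivAt_partialX hq t x).pow 2).const_mul (c ^ 2)).div_const 2)).const_mul
      (Real.exp (a * t + 0))).const_mul k), ?_⟩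
  rw [partialX_partialT hU]
  simp only [add_zero, Pi.mul_apply]
  ring

/-- In terms of `w = e^{at/2} u` the equation is an undamped wave equation whose nonlinearity
depends on `x - v t` and `w`, and `e^{at/2} (w_t + v w_x)` is the multiplier of energy and momentum
in the moving frame. -/
theorem isMultiplier_travelling {n : ℕ∞} (hn : n ≠ 0) (c a k v : ℝ) {f : ℝ → ℝ → ℝ}
    (hf : ContDiff ℝ n fun z : ℝ × ℝ => f z.1 z.2) :
    IsMultiplier n c
      (fun t x u p =>
        a * p + f (x - v * t) (Real.exp (a / 2 * t) * u) * Real.exp (-(a / 2) * t))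
      (fun t _ u p q => k * (Real.exp (a * t) * (p + v * q + a / 2 * u))) := by
  obtain ⟨F, hF, hFd⟩ := exists_contDiff_primitive hf
  have hFdiff : Differentiable ℝ F := hF.differentiable (by exact_mod_cast hn)
  refine isMultiplier_of_firstOrder
    (T := fun w => k * (Real.exp (a * w.1 + 0) *
      ((w.2.2.2.1 + a / 2 * w.2.2.1) ^ 2 / 2 + c ^ 2 * w.2.2.2.2 ^ 2 / 2 +
        v * ((w.2.2.2.1 + a / 2 * w.2.2.1) * w.2.2.2.2) - a ^ 2 / 8 * w.2.2.1 ^ 2) +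
      F (w.2.1 - v * w.1, Real.exp (a / 2 * w.1 + 0) * w.2.2.1)))
    (Ψ := fun w => k * (Real.exp (a * w.1 + 0) *
      (-c ^ 2 * ((w.2.2.2.1 + a / 2 * w.2.2.1) * w.2.2.2.2) -
        v * (w.2.2.2.1 + a / 2 * w.2.2.1) ^ 2 / 2 - v * c ^ 2 * w.2.2.2.2 ^ 2 / 2 -
        v * a ^ 2 / 8 * w.2.2.1 ^ 2) +
      v * F (w.2.1 - v * w.1, Real.exp (a / 2 * w.1 + 0) * w.2.2.1)))
    (by fun_prop) (by fun_prop) fun U hU t x => ?_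
  have hu := differentiable_of_contDiff_infty hU
  have hp := differentiable_of_contDiff_infty (contDiff_infty_partialT hU)
  have hq := differentiable_of_contDiff_infty (contDiff_infty_partialX hU)
  have ut := hasDerivAt_partialT hu t x
  have ux := hasDerivAt_partialX hu t x
  have pt := hasDerivAt_partialT hp t x
  have px := hasDerivAt_partialX hp t x
  have qt := hasDerivAt_partialT hq t x
  have qx := hasDerivAt_partialX hq t x
  have hFt := hasDerivAt_comp_curve hFdiff (((hasDerivAt_id t).const_mul v).const_sub x)
    ((hasDerivAt_exp_linear (a / 2) 0 t).mul ut)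
  have hFx := hasDerivAt_comp_curve hFdiff ((hasDerivAt_id x).sub_const (v * t))
    (ux.const_mul (Real.exp (a / 2 * t + 0)))
  simp only [id, Pi.mul_apply] at hFt hFx
  have hFw := (hasDerivAt_partialX hFdiff (x - v * t) (Real.exp (a / 2 * t + 0) * U (t, x))).unique
    (hFd _ _)
  rw [hFw] at hFt hFx
  have Pt := pt.add (ut.const_mul (a / 2))
  have Px := px.add (ux.const_mul (a / 2))
  refine ⟨_, _, (((hasDerivAt_exp_linear a 0 t).mul
      (((((Pt.pow 2).div_const 2).add (((qt.pow 2).const_mul (c ^ 2)).div_const 2)).add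
        ((Pt.mul qt).const_mul v)).sub ((ut.pow 2).const_mul (a ^ 2 / 8)))).add hFt).const_mul k,
    ((((((Px.mul qx).const_mul (-c ^ 2)).sub (((Px.pow 2).const_mul v).div_const 2)).sub
        (((qx.pow 2).const_mul (v * c ^ 2)).div_const 2)).sub
        ((ux.pow 2).const_mul (v * a ^ 2 / 8))).const_mul (Real.exp (a * t + 0)) |>.add
        (hFx.const_mul v)).const_mul k, ?_⟩
  have he : Real.exp (a * t) * Real.exp (-(a / 2) * t) = Real.exp (a / 2 * t) := by
    rw [← Real.exp_add]; congr 1; ring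
  rw [partialX_partialT hU]
  simp only [add_zero, Pi.add_apply, Pi.sub_apply, Pi.mul_apply, Pi.pow_apply]
  linear_combination k * f (x - v * t) (Real.exp (a / 2 * t) * U (t, x)) *
    (partialT U (t, x) + v * partialX U (t, x) + a / 2 * U (t, x)) * he

/-- The multiplier along a characteristic direction `∂_t - s ∂_x`, where `s² = c²`. -/
theorem isMultiplier_characteristic {n : ℕ∞} (hn : n ≠ 0) (c a b k s : ℝ) (hs : s ^ 2 = c ^ 2)
    {f : ℝ → ℝ → ℝ} (hf : ContDiff ℝ n fun z : ℝ × ℝ => f z.1 z.2) :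
    IsMultiplier n c
      (fun t x u p => (a + s * b) * p + 1 / 4 * (a + s * b) ^ 2 * u +
        f (x + s * t) (Real.exp ((a + s * b) / 2 * t) * u) *
          Real.exp (-((a - 3 * s * b) / 2) * t))
      (fun t x u p q => k * (Real.exp (a * t + b * x) * (p - s * q + (a + s * b) / 2 * u))) := by
  obtain ⟨F, hF, hFd⟩ := exists_contDiff_primitive hf
  have hFdiff : Differentiable ℝ F := hF.differentiable (by exact_mod_cast hn)
  refine isMultiplier_of_firstOrder
    (T := fun w => k * (Real.exp (a * w.1 + b * w.2.1) *
      ((w.2.2.2.1 - s * w.2.2.2.2 + (a + s * b) / 2 * w.2.2.1) ^ 2 / 2) +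
      Real.exp (b * s * w.1 + b * w.2.1) *
        F (w.2.1 + s * w.1, Real.exp ((a + s * b) / 2 * w.1 + 0) * w.2.2.1)))
    (Ψ := fun w => k * (Real.exp (b * w.2.1 + a * w.1) *
      (s * (w.2.2.2.1 - s * w.2.2.2.2 + (a + s * b) / 2 * w.2.2.1) ^ 2 / 2) -
      Real.exp (b * w.2.1 + b * s * w.1) *
        (s * F (w.2.1 + s * w.1, Real.exp ((a + s * b) / 2 * w.1 + 0) * w.2.2.1))))
    (by fun_prop) (by fun_prop) fun U hU t x => ?_
  have hu := differentiable_of_contDiff_infty hU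
  have hp := differentiable_of_contDiff_infty (contDiff_infty_partialT hU)
  have hq := differentiable_of_contDiff_infty (contDiff_infty_partialX hU)
  have ut := hasDerivAt_partialT hu t x
  have ux := hasDerivAt_partialX hu t x
  have hFt := hasDerivAt_comp_curve hFdiff (((hasDerivAt_id t).const_mul s).const_add x)
    ((hasDerivAt_exp_linear ((a + s * b) / 2) 0 t).mul ut)
  have hFx := hasDerivAt_comp_curve hFdiff ((hasDerivAt_id x).add_const (s * t))
    (ux.const_mul (Real.exp ((a + s * b) / 2 * t + 0)))
  simp only [id, Pi.mul_apply] at hFt hFx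
  have hFw := (hasDerivAt_partialX hFdiff (x + s * t)
    (Real.exp ((a + s * b) / 2 * t + 0) * U (t, x))).unique (hFd _ _)
  rw [hFw] at hFt hFx
  have ωt := ((hasDerivAt_partialT hp t x).sub ((hasDerivAt_partialT hq t x).const_mul s)).add
    (ut.const_mul ((a + s * b) / 2))
  have ωx := ((hasDerivAt_partialX hp t x).sub ((hasDerivAt_partialX hq t x).const_mul s)).add
    (ux.const_mul ((a + s * b) / 2))
  refine ⟨_, _, (((hasDerivAt_exp_linear a (b * x) t).mul ((ωt.pow 2).div_const 2)).add
      ((hasDerivAt_exp_linear (b * s) (b * x) t).mul hFt)).const_mul k,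
    (((hasDerivAt_exp_linear b (a * t) x).mul (((ωx.pow 2).const_mul s).div_const 2)).sub
      ((hasDerivAt_exp_linear b (b * s * t) x).mul (hFx.const_mul s))).const_mul k, ?_⟩
  have h1 : Real.exp (b * x + a * t) = Real.exp (a * t + b * x) := by rw [add_comm]
  have h2 : Real.exp (b * x + b * s * t) = Real.exp (b * s * t + b * x) := by rw [add_comm]
  have he : Real.exp (a * t + b * x) * Real.exp (-((a - 3 * s * b) / 2) * t) =
      Real.exp (b * s * t + b * x) * Real.exp ((a + s * b) / 2 * t) := by
    rw [← Real.exp_add, ← Real.exp_add]; congr 1; ring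
  rw [partialX_partialT hU, h1, h2]
  simp only [add_zero, Pi.add_apply, Pi.sub_apply, Pi.pow_apply]
  linear_combination k * f (x + s * t) (Real.exp ((a + s * b) / 2 * t) * U (t, x)) *
    (partialT U (t, x) - s * partialX U (t, x) + (a + s * b) / 2 * U (t, x)) * he +
    k * Real.exp (a * t + b * x) * partialX (partialX U) (t, x) *
    (partialT U (t, x) - s * partialX U (t, x) + (a + s * b) / 2 * U (t, x)) * hs

/-! ### The reduced Lagrangian -/

/-- A function `g(t, x, u, p)` as a function on `ℝ⁴`, to which `fderiv` applies. -/
abbrev uncurry4 (g : ℝ → ℝ → ℝ → ℝ → ℝ) (y : ℝ × ℝ × ℝ × ℝ) : ℝ := g y.1 y.2.1 y.2.2.1 y.2.2.2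

/-- The first-order Lagrangian that differs from
`(u_tt - c² u_xx + g) e^{at+bx} (c₁ u_t + c₂ u_x + c₀ u)` by a divergence. -/
def reducedLagrangian (c : ℝ) (g : ℝ → ℝ → ℝ → ℝ → ℝ) (a b c₀ c₁ c₂ : ℝ)
    (w : ℝ × ℝ × ℝ × ℝ × ℝ) : ℝ :=
  Real.exp (a * w.1 + b * w.2.1) *
    (c₁ * (-a * w.2.2.2.1 ^ 2 / 2 + c ^ 2 * b * w.2.2.2.1 * w.2.2.2.2 -
        a * c ^ 2 * w.2.2.2.2 ^ 2 / 2) +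
      c₂ * (-a * w.2.2.2.1 * w.2.2.2.2 + b * w.2.2.2.1 ^ 2 / 2 +
        c ^ 2 * b * w.2.2.2.2 ^ 2 / 2) +
      c₀ * (-a * w.2.2.1 * w.2.2.2.1 - w.2.2.2.1 ^ 2 +
        c ^ 2 * (b * w.2.2.1 * w.2.2.2.2 + w.2.2.2.2 ^ 2)) +
      uncurry4 g (w.1, w.2.1, w.2.2.1, w.2.2.2.1) *
        (c₁ * w.2.2.2.1 + c₂ * w.2.2.2.2 + c₀ * w.2.2.1))

/-- The density split off from the principal part to reach `reducedLagrangian`. -/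
def principalDensity (c a b c₀ c₁ c₂ : ℝ) (w : ℝ × ℝ × ℝ × ℝ × ℝ) : ℝ :=
  Real.exp (a * w.1 + b * w.2.1) *
    (c₁ / 2 * w.2.2.2.1 ^ 2 + c₂ * (w.2.2.2.1 * w.2.2.2.2) + c₀ * (w.2.2.1 * w.2.2.2.1) +
      c₁ * c ^ 2 / 2 * w.2.2.2.2 ^ 2)

/-- The flux split off from the principal part to reach `reducedLagrangian`. -/
def principalFlux (c a b c₀ c₁ c₂ : ℝ) (w : ℝ × ℝ × ℝ × ℝ × ℝ) : ℝ :=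
  Real.exp (b * w.2.1 + a * w.1) *
    (-(c₂ / 2) * w.2.2.2.1 ^ 2 - c ^ 2 * c₁ * (w.2.2.2.1 * w.2.2.2.2) -
      c ^ 2 * c₂ / 2 * w.2.2.2.2 ^ 2 - c ^ 2 * c₀ * (w.2.2.1 * w.2.2.2.2))

theorem contDiff_principalDensity {n : WithTop ℕ∞} (c a b c₀ c₁ c₂ : ℝ) :
    ContDiff ℝ n (principalDensity c a b c₀ c₁ c₂) := by
  unfold principalDensity; fun_prop

theorem contDiff_principalFlux {n : WithTop ℕ∞} (c a b c₀ c₁ c₂ : ℝ) :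
    ContDiff ℝ n (principalFlux c a b c₀ c₁ c₂) := by
  unfold principalFlux; fun_prop

/-- Splitting off the divergence of `principalDensity` and `principalFlux` removes the second
derivatives of `U`. -/
theorem multiplier_expression_eq (c : ℝ) (g : ℝ → ℝ → ℝ → ℝ → ℝ) (a b c₀ c₁ c₂ : ℝ)
    {U : ℝ × ℝ → ℝ} (hU : ContDiff ℝ ∞ U) (z : ℝ × ℝ) :
    (partialT (partialT U) z - c ^ 2 * partialX (partialX U) z +
        g z.1 z.2 (U z) (partialT U z)) *
        linQ a b c₀ c₁ c₂ z.1 z.2 (U z) (partialT U z) (partialX U z) =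
      partialT (fun y => principalDensity c a b c₀ c₁ c₂ (firstJet U y)) z +
      partialX (fun y => principalFlux c a b c₀ c₁ c₂ (firstJet U y)) z +
      reducedLagrangian c g a b c₀ c₁ c₂ (firstJet U z) := by
  obtain ⟨t, x⟩ := z
  have hu := differentiable_of_contDiff_infty hU
  have hp := differentiable_of_contDiff_infty (contDiff_infty_partialT hU)
  have hq := differentiable_of_contDiff_infty (contDiff_infty_partialX hU)
  have ut := hasDerivAt_partialT hu t x
  have ux := hasDerivAt_partialX hu t x
  have pt := hasDerivAt_partialT hp t x
  have px := hasDerivAt_partialX hp t x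
  have qt := hasDerivAt_partialT hq t x
  have qx := hasDerivAt_partialX hq t x
  have hM : Differentiable ℝ fun y => principalDensity c a b c₀ c₁ c₂ (firstJet U y) :=
    ((contDiff_principalDensity (n := ∞) c a b c₀ c₁ c₂).comp
      (contDiff_firstJet hU)).differentiable (by simp)
  have hP : Differentiable ℝ fun y => principalFlux c a b c₀ c₁ c₂ (firstJet U y) :=
    ((contDiff_principalFlux (n := ∞) c a b c₀ c₁ c₂).comp
      (contDiff_firstJet hU)).differentiable (by simp)
  have h1 := (hasDerivAt_partialT hM t x).unique
    ((hasDerivAt_exp_linear a (b * x) t).mul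
      (((((pt.pow 2).const_mul (c₁ / 2)).add ((pt.mul qt).const_mul c₂)).add
        ((ut.mul pt).const_mul c₀)).add ((qt.pow 2).const_mul (c₁ * c ^ 2 / 2))))
  have h2 := (hasDerivAt_partialX hP t x).unique
    ((hasDerivAt_exp_linear b (a * t) x).mul
      (((((px.pow 2).const_mul (-(c₂ / 2))).sub ((px.mul qx).const_mul (c ^ 2 * c₁))).sub
        ((qx.pow 2).const_mul (c ^ 2 * c₂ / 2))).sub ((ux.mul qx).const_mul (c ^ 2 * c₀))))
  have h3 : Real.exp (b * x + a * t) = Real.exp (a * t + b * x) := by rw [add_comm]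
  rw [h1, h2, h3, partialX_partialT hU]
  simp only [reducedLagrangian, linQ, firstJet]
  ring

/-- If `linQ` is a multiplier, the action of the reduced Lagrangian does not change under
compactly supported variations. -/
theorem integral_reducedLagrangian_variation {n : ℕ∞} (hn : n ≠ 0) {c : ℝ}
    {g : ℝ → ℝ → ℝ → ℝ → ℝ} {a b c₀ c₁ c₂ : ℝ}
    (h : IsMultiplier n c g (linQ a b c₀ c₁ c₂)) {U φ : ℝ × ℝ → ℝ} (hU : ContDiff ℝ ∞ U)
    (hφ : ContDiff ℝ ∞ φ) (hφc : HasCompactSupport φ) :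
    ∫ z, (reducedLagrangian c g a b c₀ c₁ c₂ (firstJet (fun y => U y + φ y) z) -
      reducedLagrangian c g a b c₀ c₁ c₂ (firstJet U z)) = 0 := by
  obtain ⟨N, T, Ψ, hT, hΨ, h⟩ := isMultiplier_iff.mp h
  have h1n : (1 : WithTop ℕ∞) ≤ n := WithTop.coe_le_coe.mpr (Order.one_le_iff_ne_zero.mpr hn)
  -- Density and flux of the reduced Lagrangian along an arbitrary function `V`.
  set A : (ℝ × ℝ → ℝ) → ℝ × ℝ → ℝ := fun V z =>
    T (jetAt N V z) - principalDensity c a b c₀ c₁ c₂ (firstJet V z) with hA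
  set B : (ℝ × ℝ → ℝ) → ℝ × ℝ → ℝ := fun V z =>
    Ψ (jetAt N V z) - principalFlux c a b c₀ c₁ c₂ (firstJet V z) with hB
  have hone : (1 : WithTop ℕ∞) ≤ ∞ := by norm_cast
  have hTV : ∀ {V : ℝ × ℝ → ℝ}, ContDiff ℝ ∞ V → ContDiff ℝ 1 fun z => T (jetAt N V z) :=
    fun hV => (hT.of_le h1n).comp ((contDiff_jetAt N hV).of_le hone)
  have hΨV : ∀ {V : ℝ × ℝ → ℝ}, ContDiff ℝ ∞ V → ContDiff ℝ 1 fun z => Ψ (jetAt N V z) :=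
    fun hV => (hΨ.of_le h1n).comp ((contDiff_jetAt N hV).of_le hone)
  have hMV : ∀ {V : ℝ × ℝ → ℝ}, ContDiff ℝ ∞ V →
      ContDiff ℝ 1 fun z => principalDensity c a b c₀ c₁ c₂ (firstJet V z) :=
    fun hV => (contDiff_principalDensity ..).comp ((contDiff_firstJet hV).of_le hone)
  have hPV : ∀ {V : ℝ × ℝ → ℝ}, ContDiff ℝ ∞ V →
      ContDiff ℝ 1 fun z => principalFlux c a b c₀ c₁ c₂ (firstJet V z) :=
    fun hV => (contDiff_principalFlux ..).comp ((contDiff_firstJet hV).of_le hone)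
  have hAV : ∀ {V : ℝ × ℝ → ℝ}, ContDiff ℝ ∞ V → ContDiff ℝ 1 (A V) := fun hV =>
    (hTV hV).sub (hMV hV)
  have hBV : ∀ {V : ℝ × ℝ → ℝ}, ContDiff ℝ ∞ V → ContDiff ℝ 1 (B V) := fun hV =>
    (hΨV hV).sub (hPV hV)
  have hdiv : ∀ {V : ℝ × ℝ → ℝ}, ContDiff ℝ ∞ V → ∀ z,
      reducedLagrangian c g a b c₀ c₁ c₂ (firstJet V z) = partialT (A V) z + partialX (B V) z := by
    rintro V hV ⟨t, x⟩
    have e1 := h V hV t x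
    have e2 := multiplier_expression_eq c g a b c₀ c₁ c₂ hV (t, x)
    have dT := (hTV hV).differentiable (by simp)
    have dΨ := (hΨV hV).differentiable (by simp)
    rw [(hasDerivAt_partialT dT t x).deriv, (hasDerivAt_partialX dΨ t x).deriv] at e1
    rw [hA, hB, partialT_sub dT ((hMV hV).differentiable (by simp)),
      partialX_sub dΨ ((hPV hV).differentiable (by simp))]
    simp only at e2
    linarith
  have hUφ : ContDiff ℝ ∞ fun y => U y + φ y := hU.add hφ
  have hloc : ∀ z, z ∉ tsupport φ → (fun y => U y + φ y) =ᶠ[nhds z] U := fun z hz => by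
    filter_upwards [notMem_tsupport_iff_eventuallyEq.mp hz] with y hy
    simp [hy]
  have hAc : HasCompactSupport fun z => A (fun y => U y + φ y) z - A U z :=
    HasCompactSupport.intro hφc fun z hz => by
      simp only [hA, jetAt_congr N (hloc z hz), firstJet_congr (hloc z hz), sub_self]
  have hBc : HasCompactSupport fun z => B (fun y => U y + φ y) z - B U z :=
    HasCompactSupport.intro hφc fun z hz => by
      simp only [hB, jetAt_congr N (hloc z hz), firstJet_congr (hloc z hz), sub_self]
  -- The difference of the two densities (and of the two fluxes) is supported in `tsupport φ`.
  rw [← integral_divergence_eq_zero ((hAV hUφ).sub (hAV hU)) hAc ((hBV hUφ).sub (hBV hU)) hBc]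
  refine congrArg _ (funext fun z => ?_)
  rw [partialT_sub ((hAV hUφ).differentiable (by simp)) ((hAV hU).differentiable (by simp)),
    partialX_sub ((hBV hUφ).differentiable (by simp)) ((hBV hU).differentiable (by simp)),
    hdiv hUφ, hdiv hU]
  ring

/-! ### The determining equation -/

/-- Splitting of a directional derivative into the four partial derivatives. -/
theorem hasDerivAt_comp_curve_four {G : ℝ × ℝ × ℝ × ℝ → ℝ} (hG : Differentiable ℝ G)
    {γ₁ γ₂ γ₃ γ₄ : ℝ → ℝ} {d₁ d₂ d₃ d₄ t : ℝ} (h₁ : HasDerivAt γ₁ d₁ t)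
    (h₂ : HasDerivAt γ₂ d₂ t) (h₃ : HasDerivAt γ₃ d₃ t) (h₄ : HasDerivAt γ₄ d₄ t) :
    HasDerivAt (fun s => G (γ₁ s, γ₂ s, γ₃ s, γ₄ s))
      (d₁ * fderiv ℝ G (γ₁ t, γ₂ t, γ₃ t, γ₄ t) (1, 0, 0, 0) +
        d₂ * fderiv ℝ G (γ₁ t, γ₂ t, γ₃ t, γ₄ t) (0, 1, 0, 0) +
        d₃ * fderiv ℝ G (γ₁ t, γ₂ t, γ₃ t, γ₄ t) (0, 0, 1, 0) +
        d₄ * fderiv ℝ G (γ₁ t, γ₂ t, γ₃ t, γ₄ t) (0, 0, 0, 1)) t := by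
  have h := (hG (γ₁ t, γ₂ t, γ₃ t, γ₄ t)).hasFDerivAt.comp_hasDerivAt t
    (h₁.prodMk (h₂.prodMk (h₃.prodMk h₄)))
  have e : (d₁, d₂, d₃, d₄) = d₁ • ((1 : ℝ), (0 : ℝ), (0 : ℝ), (0 : ℝ)) +
      d₂ • ((0 : ℝ), (1 : ℝ), (0 : ℝ), (0 : ℝ)) + d₃ • ((0 : ℝ), (0 : ℝ), (1 : ℝ), (0 : ℝ)) +
      d₄ • ((0 : ℝ), (0 : ℝ), (0 : ℝ), (1 : ℝ)) := by simp
  rw [e, map_add, map_add, map_add, map_smul, map_smul, map_smul, map_smul] at h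
  exact h

/-- The quadratic polynomial with prescribed second-order Taylor coefficients at `(t₀, x₀)`. -/
def quadraticAt (t₀ x₀ u p q r s m : ℝ) (z : ℝ × ℝ) : ℝ :=
  u + p * (z.1 - t₀) + q * (z.2 - x₀) + r / 2 * (z.1 - t₀) ^ 2 +
    s * ((z.1 - t₀) * (z.2 - x₀)) + m / 2 * (z.2 - x₀) ^ 2

theorem contDiff_quadraticAt (t₀ x₀ u p q r s m : ℝ) :
    ContDiff ℝ ∞ (quadraticAt t₀ x₀ u p q r s m) := by
  unfold quadraticAt; fun_prop

theorem partialT_quadraticAt (t₀ x₀ u p q r s m : ℝ) :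
    partialT (quadraticAt t₀ x₀ u p q r s m) =
      fun z => p + r * (z.1 - t₀) + s * (z.2 - x₀) := by
  ext ⟨t, x⟩
  have d := (hasDerivAt_id t).sub_const t₀
  refine (hasDerivAt_partialT (differentiable_of_contDiff_infty
    (contDiff_quadraticAt t₀ x₀ u p q r s m)) t x).unique ?_
  refine HasDerivAt.congr_deriv ((((((d.const_mul p).const_add u).add_const
    (q * (x - x₀))).add ((d.pow 2).const_mul (r / 2))).add
    ((d.mul_const (x - x₀)).const_mul s)).add_const (m / 2 * (x - x₀) ^ 2)) ?_
  simp
  ring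

theorem partialX_quadraticAt (t₀ x₀ u p q r s m : ℝ) :
    partialX (quadraticAt t₀ x₀ u p q r s m) =
      fun z => q + s * (z.1 - t₀) + m * (z.2 - x₀) := by
  ext ⟨t, x⟩
  have d := (hasDerivAt_id x).sub_const x₀
  refine (hasDerivAt_partialX (differentiable_of_contDiff_infty
    (contDiff_quadraticAt t₀ x₀ u p q r s m)) t x).unique ?_
  refine HasDerivAt.congr_deriv ((((((d.const_mul q).const_add (u + p * (t - t₀))).add_const
    (r / 2 * (t - t₀) ^ 2)).add
    ((d.const_mul (t - t₀)).const_mul s)).add ((d.pow 2).const_mul (m / 2)))) ?_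
  simp
  ring

theorem partialT_affine (t₀ x₀ α β γ : ℝ) (z : ℝ × ℝ) :
    partialT (fun z => α + β * (z.1 - t₀) + γ * (z.2 - x₀)) z = β := by
  have h : (fun z : ℝ × ℝ => α + β * (z.1 - t₀) + γ * (z.2 - x₀)) =
      quadraticAt t₀ x₀ α β γ 0 0 0 := by
    ext z; simp [quadraticAt]
  simp [h, partialT_quadraticAt]

theorem partialX_affine (t₀ x₀ α β γ : ℝ) (z : ℝ × ℝ) :
    partialX (fun z => α + β * (z.1 - t₀) + γ * (z.2 - x₀)) z = γ := by
  have h : (fun z : ℝ × ℝ => α + β * (z.1 - t₀) + γ * (z.2 - x₀)) =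
      quadraticAt t₀ x₀ α β γ 0 0 0 := by
    ext z; simp [quadraticAt]
  simp [h, partialX_quadraticAt]

/-- The determining equation: the Euler–Lagrange equation of the multiplier expression, at an
arbitrary point and for arbitrary values `u, p, q, r, s, m` of
`u, u_t, u_x, u_tt, u_tx, u_xx`. -/
theorem determining_equation {n : ℕ∞} (hn : 2 ≤ n) {c : ℝ} {g : ℝ → ℝ → ℝ → ℝ → ℝ}
    (hg : ContDiff ℝ n (uncurry4 g)) {a b c₀ c₁ c₂ : ℝ}
    (h : IsMultiplier n c g (linQ a b c₀ c₁ c₂)) (t x u p q r s m : ℝ) :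
    let D := fderiv ℝ (uncurry4 g) (t, x, u, p)
    let D' := fderiv ℝ (fun y => fderiv ℝ (uncurry4 g) y (0, 0, 0, 1)) (t, x, u, p)
    let W := c₁ * p + c₂ * q + c₀ * u
    (2 * a * c₁ - D' (0, 0, 0, 1) * W - 2 * c₁ * D (0, 0, 0, 1) +
        (2 * c₀ - a * c₁ - b * c₂)) * r +
      (2 * a * c₂ - 2 * c ^ 2 * b * c₁ - 2 * c₂ * D (0, 0, 0, 1)) * s -
      c ^ 2 * (2 * c₀ - a * c₁ + b * c₂) * m +
      ((a ^ 2 - c ^ 2 * b ^ 2) * W + 2 * a * c₀ * p - 2 * c ^ 2 * b * c₀ * q +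
        D (0, 0, 1, 0) * (c₀ * u) - a * D (0, 0, 0, 1) * W -
        (D' (1, 0, 0, 0) + D' (0, 0, 1, 0) * p) * W - D (0, 0, 0, 1) * c₀ * p +
        (c₀ - a * c₁ - b * c₂) * g t x u p - c₁ * D (1, 0, 0, 0) - c₂ * D (0, 1, 0, 0)) = 0 := by
  intro D D' W
  have h2n : (2 : WithTop ℕ∞) ≤ n := WithTop.coe_le_coe.mpr hn
  have hn0 : n ≠ 0 := by rintro rfl; simp at hn
  have hg2 : ContDiff ℝ 2 (uncurry4 g) := hg.of_le h2n
  have hgd : Differentiable ℝ (uncurry4 g) := hg2.differentiable (by simp)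
  have hg' : ContDiff ℝ 1 fun y => fderiv ℝ (uncurry4 g) y (0, 0, 0, 1) :=
    (hg2.fderiv_right (by norm_num)).clm_apply contDiff_const
  have hgd' := hg'.differentiable (by simp)
  set L := reducedLagrangian c g a b c₀ c₁ c₂ with hLdef
  have hL : ContDiff ℝ 2 L := by
    rw [hLdef]; unfold reducedLagrangian; fun_prop
  have hLd : Differentiable ℝ L := hL.differentiable (by simp)
  set U := quadraticAt t x u p q r s m with hUdef
  have hU : ContDiff ℝ ∞ U := contDiff_quadraticAt ..
  have hEL := eulerLagrange hL
    (fun V φ hV hφ hφc => integral_reducedLagrangian_variation hn0 h hV hφ hφc) hU (t, x)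
  -- The partial derivatives of the Lagrangian with respect to `u`, `u_t` and `u_x`.
  have hLu : ∀ t x u p q, fderiv ℝ L (t, x, u, p, q) (0, 0, 1, 0, 0) =
      Real.exp (a * t + b * x) * (c₀ * (-a * p + c ^ 2 * b * q) +
        fderiv ℝ (uncurry4 g) (t, x, u, p) (0, 0, 1, 0) * (c₁ * p + c₂ * q + c₀ * u) +
        g t x u p * c₀) := by
    intro t x u p q
    have d := hasDerivAt_id u
    have dG := hasDerivAt_comp_curve_four hgd (hasDerivAt_const u t) (hasDerivAt_const u x) d
      (hasDerivAt_const u p)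
    have e := (hLd (t, x, u, p, q)).hasFDerivAt.comp_hasDerivAt u
      ((hasDerivAt_const u t).prodMk ((hasDerivAt_const u x).prodMk
        (d.prodMk ((hasDerivAt_const u p).prodMk (hasDerivAt_const u q)))))
    refine e.unique (HasDerivAt.congr_deriv ((((((((d.const_mul (-a)).mul_const p).sub_const
      (p ^ 2)).add ((((d.const_mul b).mul_const q).add_const (q ^ 2)).const_mul
      (c ^ 2))).const_mul c₀).const_add (c₁ * (-a * p ^ 2 / 2 + c ^ 2 * b * p * q -
        a * c ^ 2 * q ^ 2 / 2) + c₂ * (-a * p * q + b * p ^ 2 / 2 + c ^ 2 * b * q ^ 2 / 2))).add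
      (dG.mul ((d.const_mul c₀).const_add (c₁ * p + c₂ * q)))).const_mul
      (Real.exp (a * t + b * x))) ?_)
    simp
    ring
  have hLp : ∀ t x u p q, fderiv ℝ L (t, x, u, p, q) (0, 0, 0, 1, 0) =
      Real.exp (a * t + b * x) * (c₁ * (-a * p + c ^ 2 * b * q) + c₂ * (-a * q + b * p) +
        c₀ * (-a * u - 2 * p) +
        fderiv ℝ (uncurry4 g) (t, x, u, p) (0, 0, 0, 1) * (c₁ * p + c₂ * q + c₀ * u) +
        uncurry4 g (t, x, u, p) * c₁) := by
    intro t x u p q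
    have d := hasDerivAt_id p
    have dG := hasDerivAt_comp_curve_four hgd (hasDerivAt_const p t) (hasDerivAt_const p x)
      (hasDerivAt_const p u) d
    have e := (hLd (t, x, u, p, q)).hasFDerivAt.comp_hasDerivAt p
      ((hasDerivAt_const p t).prodMk ((hasDerivAt_const p x).prodMk
        ((hasDerivAt_const p u).prodMk (d.prodMk (hasDerivAt_const p q)))))
    refine e.unique (HasDerivAt.congr_deriv ((((((((((d.pow 2).const_mul (-a)).div_const 2).add
      ((d.const_mul (c ^ 2 * b)).mul_const q)).sub_const (a * c ^ 2 * q ^ 2 / 2)).const_mul c₁).add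
      (((((d.const_mul (-a)).mul_const q).add (((d.pow 2).const_mul b).div_const 2)).add_const
        (c ^ 2 * b * q ^ 2 / 2)).const_mul c₂)).add
      ((((d.const_mul (-a * u)).sub (d.pow 2)).add_const
        (c ^ 2 * (b * u * q + q ^ 2))).const_mul c₀)).add
      (dG.mul (((d.const_mul c₁).add_const (c₂ * q)).add_const (c₀ * u)))).const_mul
      (Real.exp (a * t + b * x))) ?_)
    simp
    ring
  have hLq : ∀ t x u p q, fderiv ℝ L (t, x, u, p, q) (0, 0, 0, 0, 1) =
      Real.exp (a * t + b * x) * (c₁ * (c ^ 2 * b * p - a * c ^ 2 * q) +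
        c₂ * (-a * p + c ^ 2 * b * q) + c₀ * (c ^ 2 * (b * u + 2 * q)) +
        uncurry4 g (t, x, u, p) * c₂) := by
    intro t x u p q
    have d := hasDerivAt_id q
    have e := (hLd (t, x, u, p, q)).hasFDerivAt.comp_hasDerivAt q
      ((hasDerivAt_const q t).prodMk ((hasDerivAt_const q x).prodMk
        ((hasDerivAt_const q u).prodMk ((hasDerivAt_const q p).prodMk d))))
    refine e.unique (HasDerivAt.congr_deriv (((((((d.const_mul (c ^ 2 * b * p)).const_add
      (-a * p ^ 2 / 2)).sub (((d.pow 2).const_mul (a * c ^ 2)).div_const 2)).const_mul c₁).add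
      ((((d.const_mul (-a * p)).add_const (b * p ^ 2 / 2)).add
        (((d.pow 2).const_mul (c ^ 2 * b)).div_const 2)).const_mul c₂)).add
      (((((d.const_mul (b * u)).add (d.pow 2)).const_mul (c ^ 2)).const_add
        (-a * u * p - p ^ 2)).const_mul c₀)).add
      ((((d.const_mul c₂).const_add (c₁ * p)).add_const (c₀ * u)).const_mul
        (uncurry4 g (t, x, u, p))) |>.const_mul (Real.exp (a * t + b * x))) ?_)
    simp
    ring
  have hc : ∀ v, Differentiable ℝ fun y => fderiv ℝ L (firstJet U y) v := fun v =>
    (((hL.fderiv_right (m := 1) (by norm_num)).comp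
      ((contDiff_firstJet hU).of_le (by norm_cast))).clm_apply contDiff_const).differentiable
        (by simp)
  have hu := differentiable_of_contDiff_infty hU
  have hp := differentiable_of_contDiff_infty (contDiff_infty_partialT hU)
  have hq := differentiable_of_contDiff_infty (contDiff_infty_partialX hU)
  have ut := hasDerivAt_partialT hu t x
  have ux := hasDerivAt_partialX hu t x
  have pt := hasDerivAt_partialT hp t x
  have px := hasDerivAt_partialX hp t x
  have qt := hasDerivAt_partialT hq t x
  have qx := hasDerivAt_partialX hq t x
  have DtLp := hasDerivAt_partialT (hc (0, 0, 0, 1, 0)) t x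
  have DxLq := hasDerivAt_partialX (hc (0, 0, 0, 0, 1)) t x
  simp only [firstJet, hLp] at DtLp
  simp only [firstJet, hLq] at DxLq
  have gt := hasDerivAt_comp_curve_four hgd (hasDerivAt_id t) (hasDerivAt_const t x) ut pt
  have gx := hasDerivAt_comp_curve_four hgd (hasDerivAt_const x t) (hasDerivAt_id x) ux px
  have gpt := hasDerivAt_comp_curve_four hgd' (hasDerivAt_id t) (hasDerivAt_const t x) ut pt
  have e1 := DtLp.unique ((hasDerivAt_exp_linear a (b * x) t).mul
    (((((((pt.const_mul (-a)).add (qt.const_mul (c ^ 2 * b))).const_mul c₁).add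
      (((qt.const_mul (-a)).add (pt.const_mul b)).const_mul c₂)).add
      (((ut.const_mul (-a)).sub (pt.const_mul 2)).const_mul c₀)).add
      (gpt.mul (((pt.const_mul c₁).add (qt.const_mul c₂)).add (ut.const_mul c₀)))).add
      (gt.mul_const c₁)))
  have he : ∀ y, Real.exp (a * t + b * y) = Real.exp (b * y + a * t) := fun y => by rw [add_comm]
  simp only [he] at DxLq
  have e2 := DxLq.unique ((hasDerivAt_exp_linear b (a * t) x).mul
    ((((((px.const_mul (c ^ 2 * b)).sub (qx.const_mul (a * c ^ 2))).const_mul c₁).add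
      (((px.const_mul (-a)).add (qx.const_mul (c ^ 2 * b))).const_mul c₂)).add
      ((((ux.const_mul b).add (qx.const_mul 2)).const_mul (c ^ 2)).const_mul c₀)).add
      (gx.mul_const c₂)))
  have v0 : U (t, x) = u := by simp [hUdef, quadraticAt]
  have v1 : partialT U (t, x) = p := by simp [hUdef, partialT_quadraticAt]
  have v2 : partialX U (t, x) = q := by simp [hUdef, partialX_quadraticAt]
  have v3 : partialT (partialT U) (t, x) = r := by
    rw [hUdef, partialT_quadraticAt, partialT_affine]
  have v4 : partialT (partialX U) (t, x) = s := by
    rw [hUdef, partialX_quadraticAt, partialT_affine]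
  have v5 : partialX (partialX U) (t, x) = m := by
    rw [hUdef, partialX_quadraticAt, partialX_affine]
  simp only [firstJet, hLu, hLp, hLq] at hEL
  rw [e1, e2] at hEL
  simp only [id, Pi.add_apply, partialX_partialT hU, v0, v1, v2, v3, v4, v5, ← he x] at hEL
  refine (mul_eq_zero.mp ?_).resolve_left (Real.exp_ne_zero (a * t + b * x))
  simp only [D, D', W]
  linear_combination hEL

/-! ### Solving the determining equation -/

/-- A multiplier of the form `linQ` forces `g` to be affine in `u_t`, with constant slope `α`. The
three relations are what the coefficients of `u_tt`, `u_tx`, `u_xx` in the determining equation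
leave, and the last clause is the rest of that equation at `u_t = u_x = 0`. -/
theorem exists_constant_damping {n : ℕ∞} (hn : 2 ≤ n) {c : ℝ} (hc : 0 < c)
    {g : ℝ → ℝ → ℝ → ℝ → ℝ} (hg : ContDiff ℝ n (uncurry4 g)) {a b c₀ c₁ c₂ : ℝ}
    (hne : ¬(c₀ = 0 ∧ c₁ = 0 ∧ c₂ = 0)) (h : IsMultiplier n c g (linQ a b c₀ c₁ c₂)) :
    ∃ α : ℝ, (∀ t x u p, g t x u p = α * p + g t x u 0) ∧
      2 * c₀ = a * c₁ - b * c₂ ∧ c₂ * (a - α) = c ^ 2 * b * c₁ ∧ c₁ * (a - α) = b * c₂ ∧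
      ∀ t x u, c₁ * fderiv ℝ (uncurry4 g) (t, x, u, 0) (1, 0, 0, 0) +
          c₂ * fderiv ℝ (uncurry4 g) (t, x, u, 0) (0, 1, 0, 0) -
          c₀ * u * fderiv ℝ (uncurry4 g) (t, x, u, 0) (0, 0, 1, 0) =
        (a ^ 2 - c ^ 2 * b ^ 2 - a * α) * (c₀ * u) + (c₀ - a * c₁ - b * c₂) * g t x u 0 := by
  have h2n : (2 : WithTop ℕ∞) ≤ n := WithTop.coe_le_coe.mpr hn
  have hg2 : ContDiff ℝ 2 (uncurry4 g) := hg.of_le h2n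
  have hgd : Differentiable ℝ (uncurry4 g) := hg2.differentiable (by simp)
  set Gp := fun y => fderiv ℝ (uncurry4 g) y (0, 0, 0, 1) with hGp
  have hGp1 : ContDiff ℝ 1 Gp :=
    (hg2.fderiv_right (by norm_num)).clm_apply contDiff_const
  have hGpd : Differentiable ℝ Gp := hGp1.differentiable (by simp)
  have hdet := determining_equation hn hg h
  simp only at hdet
  have hr : ∀ t x u p q, 2 * a * c₁ - fderiv ℝ Gp (t, x, u, p) (0, 0, 0, 1) *
      (c₁ * p + c₂ * q + c₀ * u) - 2 * c₁ * Gp (t, x, u, p) + (2 * c₀ - a * c₁ - b * c₂) = 0 :=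
    fun t x u p q => by
      linear_combination hdet t x u p q 1 0 0 - hdet t x u p q 0 0 0
  have hs : ∀ t x u p, 2 * a * c₂ - 2 * c ^ 2 * b * c₁ - 2 * c₂ * Gp (t, x, u, p) = 0 :=
    fun t x u p => by
      linear_combination hdet t x u p 0 0 1 0 - hdet t x u p 0 0 0 0
  have hm : 2 * c₀ - a * c₁ + b * c₂ = 0 := by
    have : c ^ 2 * (2 * c₀ - a * c₁ + b * c₂) = 0 := by
      linear_combination hdet 0 0 0 0 0 0 0 0 - hdet 0 0 0 0 0 0 0 1
    exact (mul_eq_zero.mp this).resolve_left (by positivity)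
  obtain ⟨α, hα⟩ : ∃ α, ∀ t x u p, Gp (t, x, u, p) = α := by
    by_cases hc2 : c₂ = 0
    · subst hc2
      have hc1 : c₁ ≠ 0 := by
        rintro rfl
        exact hne ⟨by linarith, rfl, rfl⟩
      have hc0 : c₀ = a * c₁ / 2 := by linarith
      refine ⟨a, fun t x u p => ?_⟩
      -- With `c₂ = 0` the coefficient of `u_tt` is an ordinary differential equation in `p`.
      have hr' : ∀ p, fderiv ℝ Gp (t, x, u, p) (0, 0, 0, 1) * (p + a / 2 * u) +
          2 * (Gp (t, x, u, p) - a) = 0 := fun p => by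
        have h1 := hr t x u p 0
        rw [hc0] at h1
        refine (mul_eq_zero.mp ?_).resolve_left hc1
        linear_combination -h1
      -- By `hr'`, the product `(g_p - a) (p + a u / 2)²` does not depend on `p`, and it vanishes
      -- at `p = -a u / 2`; at that point `hr'` itself gives `g_p = a`.
      have hd : ∀ p, HasDerivAt
          (fun p => (Gp (t, x, u, p) - a) * (p + a / 2 * u) ^ 2) 0 p := fun p => by
        have d := hasDerivAt_comp_curve_four hGpd (hasDerivAt_const p t) (hasDerivAt_const p x)
          (hasDerivAt_const p u) (hasDerivAt_id p)
        refine HasDerivAt.congr_deriv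
          ((d.sub_const a).mul (((hasDerivAt_id p).add_const (a / 2 * u)).pow 2)) ?_
        simp
        linear_combination (p + a / 2 * u) * hr' p
      have hconst := is_const_of_deriv_eq_zero (fun p => (hd p).differentiableAt)
        (fun p => (hd p).deriv) p (-(a / 2 * u))
      simp only [neg_add_cancel, ne_eq, OfNat.ofNat_ne_zero, not_false_eq_true, zero_pow,
        mul_zero, mul_eq_zero, pow_eq_zero_iff] at hconst
      rcases hconst with h1 | h1
      · linarith
      · have h2 := hr' p
        rw [h1] at h2
        linarith
    · refine ⟨a - c ^ 2 * b * c₁ / c₂, fun t x u p => ?_⟩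
      field_simp
      linear_combination -(1 / 2) * hs t x u p
  have hD' : ∀ y v, fderiv ℝ Gp y v = 0 := fun y v => by
    have : Gp = fun _ => α := funext fun y => hα _ _ _ _
    rw [this]
    simp
  refine ⟨α, fun t x u p => ?_, by linarith, ?_, ?_, fun t x u => ?_⟩
  · have hd : ∀ p, HasDerivAt (fun p => g t x u p - α * p) 0 p := fun p => by
      have d := hasDerivAt_comp_curve_four hgd (hasDerivAt_const p t) (hasDerivAt_const p x)
          (hasDerivAt_const p u) (hasDerivAt_id p)
      refine HasDerivAt.congr_deriv (d.sub ((hasDerivAt_id p).const_mul α)) ?_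
      have h1 := hα t x u p
      simp only [hGp] at h1
      simp [h1]
    have := is_const_of_deriv_eq_zero (fun p => (hd p).differentiableAt)
      (fun p => (hd p).deriv) p 0
    linarith
  · have := hs 0 0 0 0
    rw [hα] at this
    linarith
  · have := hr 0 0 0 0 0
    rw [hα, hD'] at this
    linarith
  · have h1 := hdet t x u 0 0 0 0 0
    have h2 := hα t x u 0
    simp only [hGp] at h2 hD'
    rw [h2, hD', hD'] at h1
    linear_combination -h1

/-- Solution of the transport equation `h_t + v h_x - κ u h_u = l h + μ u` by characteristics, for
`h = G(·, ·, ·, 0)`; the condition on `ν` says that `ν u` is a particular solution. -/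
theorem eq_of_transport {G : ℝ × ℝ × ℝ × ℝ → ℝ} (hG : Differentiable ℝ G) {v κ l μ ν : ℝ}
    (hν : -κ * ν = l * ν + μ)
    (h : ∀ t x u, fderiv ℝ G (t, x, u, 0) (1, 0, 0, 0) + v * fderiv ℝ G (t, x, u, 0) (0, 1, 0, 0) -
      κ * u * fderiv ℝ G (t, x, u, 0) (0, 0, 1, 0) = l * G (t, x, u, 0) + μ * u) (t x u : ℝ) :
    G (t, x, u, 0) = ν * u +
      (G (0, x - v * t, Real.exp (κ * t) * u, 0) - ν * (Real.exp (κ * t) * u)) *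
        Real.exp (l * t) := by
  -- Along the characteristic through `(t, x, u)`, the function `(h - ν u) e^{-l τ}` is constant.
  have hd : ∀ τ, HasDerivAt (fun τ => (G (τ, v * τ + (x - v * t),
      Real.exp (-κ * τ + κ * t) * u, 0) - ν * (Real.exp (-κ * τ + κ * t) * u)) *
      Real.exp (-l * τ + 0)) 0 τ := fun τ => by
    have de := (hasDerivAt_exp_linear (-κ) (κ * t) τ).mul_const u
    have d := hasDerivAt_comp_curve_four hG (hasDerivAt_id τ)
      (((hasDerivAt_id τ).const_mul v).add_const (x - v * t)) de (hasDerivAt_const τ 0)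
    refine HasDerivAt.congr_deriv
      ((d.sub (de.const_mul ν)).mul (hasDerivAt_exp_linear (-l) 0 τ)) ?_
    have h1 := h τ (v * τ + (x - v * t)) (Real.exp (-κ * τ + κ * t) * u)
    simp only [id, Pi.sub_apply]
    linear_combination Real.exp (-l * τ + 0) * h1 -
      Real.exp (-l * τ + 0) * (Real.exp (-κ * τ + κ * t) * u) * hν
  have hconst := is_const_of_deriv_eq_zero (fun p => (hd p).differentiableAt)
    (fun p => (hd p).deriv) t 0
  have e1 : Real.exp (-l * t) * Real.exp (l * t) = 1 := by
    rw [← Real.exp_add]; simp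
  have e2 : v * t + (x - v * t) = x := by ring
  simp only [e2, neg_mul, neg_add_cancel, Real.exp_zero, one_mul, add_zero, mul_zero,
    zero_add, mul_one] at hconst e1
  linear_combination Real.exp (l * t) * hconst - (G (t, x, u, 0) - ν * u) * e1

theorem contDiff_initial_profile {n : ℕ∞} {g : ℝ → ℝ → ℝ → ℝ → ℝ}
    (hg : ContDiff ℝ n (uncurry4 g)) (ν : ℝ) :
    ContDiff ℝ n fun z : ℝ × ℝ => g 0 z.1 z.2 0 - ν * z.2 :=
  (hg.comp (f := fun z : ℝ × ℝ => ((0 : ℝ), z.1, z.2, (0 : ℝ))) (by fun_prop)).sub (by fun_prop)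

end

end DampedWave


open DampedWave

theorem proposition1 (n : ℕ∞) (hn : 2 ≤ n) (c : ℝ) (hc : 0 < c)
    (g : ℝ → ℝ → ℝ → ℝ → ℝ)
    (hg : ContDiff ℝ n (fun z : ℝ × ℝ × ℝ × ℝ => g z.1 z.2.1 z.2.2.1 z.2.2.2))
    (a b c₀ c₁ c₂ : ℝ) (hne : ¬(c₀ = 0 ∧ c₁ = 0 ∧ c₂ = 0)) :
    DampedWave.IsMultiplier n c g (DampedWave.linQ a b c₀ c₁ c₂) ↔
      -- case (i)
      (∃ k : ℝ, k ≠ 0 ∧ ∃ f : ℝ → ℝ → ℝ, ContDiff ℝ n (fun z : ℝ × ℝ => f z.1 z.2) ∧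
        (∀ t x u p, g t x u p = a * p + f t u) ∧
        (∀ t x u p q, DampedWave.linQ a b c₀ c₁ c₂ t x u p q = k * (Real.exp (a * t) * q))) ∨
      -- case (ii), with `v` the constant speed
      (∃ k : ℝ, k ≠ 0 ∧ ∃ v : ℝ,
        ∃ f : ℝ → ℝ → ℝ, ContDiff ℝ n (fun z : ℝ × ℝ => f z.1 z.2) ∧
        (∀ t x u p, g t x u p =
          a * p + f (x - v * t) (Real.exp (a / 2 * t) * u) * Real.exp (-(a / 2) * t)) ∧
        (∀ t x u p q, DampedWave.linQ a b c₀ c₁ c₂ t x u p q =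
          k * (Real.exp (a * t) * (p + v * q + a / 2 * u)))) ∨
      -- case (iii), with `σ = 1` for the upper signs and `σ = -1` for the lower signs
      (∃ k : ℝ, k ≠ 0 ∧ ∃ σ : ℝ, (σ = 1 ∨ σ = -1) ∧
        ∃ f : ℝ → ℝ → ℝ, ContDiff ℝ n (fun z : ℝ × ℝ => f z.1 z.2) ∧
        (∀ t x u p, g t x u p =
          (a + σ * c * b) * p + 1 / 4 * (a + σ * c * b) ^ 2 * u +
            f (x + σ * c * t) (Real.exp ((a + σ * c * b) / 2 * t) * u) *
              Real.exp (-((a - 3 * σ * c * b) / 2) * t)) ∧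
        (∀ t x u p q, DampedWave.linQ a b c₀ c₁ c₂ t x u p q =
          k * (Real.exp (a * t + b * x) *
            (p - σ * c * q + (a + σ * c * b) / 2 * u)))) := by
  have h2n : (2 : WithTop ℕ∞) ≤ n := WithTop.coe_le_coe.mpr hn
  have hn0 : n ≠ 0 := by rintro rfl; simp at hn
  constructor
  · intro h
    have hG : Differentiable ℝ (uncurry4 g) := (hg.of_le h2n).differentiable (by simp)
    obtain ⟨α, hα, h0, h1, h2, htr⟩ := exists_constant_damping hn hc hg hne h
    by_cases hc1 : c₁ = 0
    · subst hc1
      have hc2 : c₂ ≠ 0 := by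
        rintro rfl
        exact hne ⟨by linarith, rfl, rfl⟩
      have hb : b = 0 := (mul_eq_zero.mp (by linarith : b * c₂ = 0)).resolve_right hc2
      subst hb
      have hc0 : c₀ = 0 := by linarith
      subst hc0
      have haα : α = a := by
        have := (mul_eq_zero.mp (by linarith : c₂ * (a - α) = 0)).resolve_left hc2
        linarith
      subst haα
      refine Or.inl ⟨c₂, hc2, fun t u => g t 0 u 0, ?_, fun t x u p => ?_, fun t x u p q => ?_⟩
      · exact hg.comp (f := fun z : ℝ × ℝ => (z.1, (0 : ℝ), z.2, (0 : ℝ))) (by fun_prop)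
      · have hd : ∀ x, HasDerivAt (fun x => g t x u 0) 0 x := fun x => by
          have h3 := htr t x u
          refine HasDerivAt.congr_deriv (hasDerivAt_comp_curve_four hG (hasDerivAt_const x t)
            (hasDerivAt_id x) (hasDerivAt_const x u) (hasDerivAt_const x 0)) ?_
          simp only [zero_mul, zero_add, one_mul, add_zero]
          refine (mul_eq_zero.mp ?_).resolve_left hc2
          linear_combination h3
        rw [hα, is_const_of_deriv_eq_zero (fun x => (hd x).differentiableAt)
          (fun x => (hd x).deriv) x 0]
      · simp only [linQ, zero_mul, add_zero, zero_add]
        ring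
    · by_cases hb : b = 0
      · subst hb
        have haα : α = a := by
          have := (mul_eq_zero.mp (by linarith : c₁ * (a - α) = 0)).resolve_left hc1
          linarith
        subst haα
        have hc0 : c₀ = α / 2 * c₁ := by linarith
        have key := eq_of_transport hG (v := c₂ / c₁) (κ := α / 2) (l := -(α / 2)) (μ := 0)
          (ν := 0) (by simp) fun t x u => by
            have h3 := htr t x u
            rw [hc0] at h3
            have h4 : c₂ / c₁ * c₁ = c₂ := div_mul_cancel₀ _ hc1
            refine mul_left_cancel₀ hc1 ?_
            linear_combination h3 + fderiv ℝ (uncurry4 g) (t, x, u, 0) (0, 1, 0, 0) * h4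
        refine Or.inr (Or.inl ⟨c₁, hc1, c₂ / c₁, fun y w => g 0 y w 0 - 0 * w,
          contDiff_initial_profile hg 0, fun t x u p => ?_, fun t x u p q => ?_⟩)
        · rw [hα]
          linear_combination key t x u
        · simp only [linQ, zero_mul, add_zero, hc0]
          field_simp
      · -- Eliminating `a - α` from the two relations: the direction is characteristic.
        have hcc : c₂ ^ 2 = (c * c₁) ^ 2 := by
          refine mul_left_cancel₀ hb ?_
          linear_combination c₁ * h1 - c₂ * h2
        obtain ⟨σ, hσ, hc2⟩ : ∃ σ : ℝ, (σ = 1 ∨ σ = -1) ∧ c₂ = -σ * c * c₁ := by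
          rcases sq_eq_sq_iff_eq_or_eq_neg.mp hcc with h3 | h3
          · exact ⟨-1, Or.inr rfl, by rw [h3]; ring⟩
          · exact ⟨1, Or.inl rfl, by rw [h3]; ring⟩
        have hσ2 : σ ^ 2 = 1 := by rcases hσ with rfl | rfl <;> norm_num
        have hαv : α = a + σ * c * b := by
          refine mul_left_cancel₀ hc1 ?_
          rw [hc2] at h2
          linear_combination -h2
        have hc0 : c₀ = (a + σ * c * b) / 2 * c₁ := by
          rw [hc2] at h0
          linear_combination h0 / 2
        have key := eq_of_transport hG (v := -σ * c) (κ := (a + σ * c * b) / 2)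
          (l := -((a - 3 * σ * c * b) / 2)) (μ := -(σ * c * b) * (a + σ * c * b) ^ 2 / 2)
          (ν := 1 / 4 * (a + σ * c * b) ^ 2) (by ring) fun t x u => by
            have h3 := htr t x u
            rw [hc0, hc2, hαv] at h3
            refine mul_left_cancel₀ hc1 ?_
            linear_combination h3 + c ^ 2 * b ^ 2 * (a + σ * c * b) / 2 * c₁ * u * hσ2
        refine Or.inr (Or.inr ⟨c₁, hc1, σ, hσ,
          fun y w => g 0 y w 0 - 1 / 4 * (a + σ * c * b) ^ 2 * w,
          contDiff_initial_profile hg _, fun t x u p => ?_, fun t x u p q => ?_⟩)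
        · have e : x + σ * c * t = x - -σ * c * t := by ring
          rw [hα, hαv, e]
          linear_combination key t x u
        · simp only [linQ, hc0, hc2]
          ring
  · rintro (⟨k, -, f, hf, hgf, hQ⟩ | ⟨k, -, v, f, hf, hgf, hQ⟩ | ⟨k, -, σ, hσ, f, hf, hgf, hQ⟩)
    · have e1 : g = fun t _ u p => a * p + f t u := by
        ext t x u p; exact hgf t x u p
      have e2 : linQ a b c₀ c₁ c₂ = fun t _ _ _ q => k * (Real.exp (a * t) * q) := by
        ext t x u p q; exact hQ t x u p q
      rw [e1, e2]
      exact isMultiplier_translation hn0 c a k hf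
    · have e1 : g = fun t x u p =>
          a * p + f (x - v * t) (Real.exp (a / 2 * t) * u) * Real.exp (-(a / 2) * t) := by
        ext t x u p; exact hgf t x u p
      have e2 : linQ a b c₀ c₁ c₂ = fun t _ u p q =>
          k * (Real.exp (a * t) * (p + v * q + a / 2 * u)) := by
        ext t x u p q; exact hQ t x u p q
      rw [e1, e2]
      exact isMultiplier_travelling hn0 c a k v hf
    · have hs : (σ * c) ^ 2 = c ^ 2 := by rcases hσ with rfl | rfl <;> ring
      have e1 : g = fun t x u p => (a + σ * c * b) * p + 1 / 4 * (a + σ * c * b) ^ 2 * u +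
          f (x + σ * c * t) (Real.exp ((a + σ * c * b) / 2 * t) * u) *
            Real.exp (-((a - 3 * (σ * c) * b) / 2) * t) := by
        ext t x u p
        rw [hgf, mul_assoc 3 σ c]
      have e2 : linQ a b c₀ c₁ c₂ = fun t x u p q =>
          k * (Real.exp (a * t + b * x) * (p - σ * c * q + (a + σ * c * b) / 2 * u)) := by
        ext t x u p q; exact hQ t x u p q
      rw [e1, e2]
      exact isMultiplier_characteristic hn0 c a b k (σ * c) hs hf
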